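/- **Setting.** Consider a stochastic linear bandit with varying, possibly infinite arm sets. In each round $t=1,\dots,T$ the learner is given an arm set $\mathcal A_t$ in which every arm $a$ has a known context vector $x_{t,a}\in\mathbb R^d$ (the arm sets and contexts form a fixed sequence), chooses an arm $A_t\in\mathcal A_t$, and receives the reward $Y_t=\langle\theta^*,X_t\rangle+\eta_t$, where $X_t:=x_{t,A_t}$, the vector $\theta^*\in\mathbb R^d$ is unknown, and the noise $\eta_t$ is conditionally $R$-sub-Gaussian: for every $s\in\mathbb R$, almost surely $\mathbb E[e^{s\eta_t}\mid A_1,\dots,A_t,Y_1,\dots,Y_{t-1}]\le e^{s^2R^2/2}$. It is assumed that $\max_{a\in\mathcal A_t}\langle\theta^*,x_{t,a}\rangle$ is attained. The expected regret is $$R_T=\mathbb E\Big[\sum_{t=1}^T\Big(\max_{a\in\mathcal A_t}\langle\theta^*,x_{t,a}\rangle-\langle\theta^*,X_t\rangle\Big)\Big].$$ **Algorithm (LinIMED-2).** Let $\lambda>0$, $V_0=\lambda I$, $W_0=0$, and for $t\ge1$ let $V_t=V_{t-1}+X_tX_t^\top$ and $W_t=W_{t-1}+Y_tX_t$; for $t\ge0$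 let $\hat\theta_t=V_t^{-1}W_t$. For $t\ge1$ and an arm $a\in\mathcal A_t$ put $\hat\mu_{t,a}=\langle\hat\theta_{t-1},x_{t,a}\rangle$, $\hat\Delta_{t,a}=\max_{j\in\mathcal A_t}\hat\mu_{t,j}-\hat\mu_{t,a}$ and $w_{t,a}=\beta_{t-1}\,x_{t,a}^\top V_{t-1}^{-1}x_{t,a}$, where $$\beta_{t-1}=\Big(R\sqrt{d\log\frac{1+(t-1)L^2/\lambda}{\gamma}}+\sqrt\lambda\,S\Big)^2,\qquad \gamma=\frac1{t^2}.$$ The index of an empirically best arm (a maximizer $a$ of $\hat\mu_{t,\cdot}$ over $\mathcal A_t$, ties broken arbitrarily) is $I_{t,a}=\min\{\log T,\,-\log w_{t,a}\}$, and the index of every other arm is $I_{t,a}=\hat\Delta_{t,a}^2/w_{t,a}-\log w_{t,a}$; for an arm with $x_{t,a}=0$ these are read as $\log T$ and $+\infty$. In round $t$ the algorithm pulls $A_t\in\arg\min_{a\in\mathcal A_t}I_{t,a}$, ties broken arbitrarily (the maximum of $\hat\mu_{t,\cdot}$ and the minimum of $I_{t,\cdot}$ over $\mathcal A_t$ are assumed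 to be attained). **Theorem.** Let $L,S,\lambda>0$ and $R\ge0$ with $\sqrt\lambda\,S\ge1$. There is a constant $C$ that depends only on $L,S,R,\lambda$ such that the following holds for every dimension $d$, every horizon $T\ge2$ and every bandit as above. If $\|X_t\|\le L$ for all $t\le T$, $\|\theta^*\|\le S$, and $\max_{a\in\mathcal A_t}\langle\theta^*,x_{t,a}\rangle-\langle\theta^*,x_{t,b}\rangle\le1$ for all $t\le T$ and $b\in\mathcal A_t$, then LinIMED-2 has expected regret $$R_T\le C\,d\,\sqrt T\,(\log T)^{3/2}.$$ -/

import Mathlib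

open MeasureTheory

noncomputable section

namespace LinIMED

/-- The data of a stochastic linear bandit with varying arm sets: in round `t = 1, 2, …` the arms
are the elements of `arms t`, the arm `a` has the context (arm vector) `ctx t a`, and `theta` is the
unknown coefficient vector. -/
structure Bandit (d : ℕ) (Arm : Type*) where
  arms : ℕ → Set Arm
  ctx : ℕ → Arm → EuclideanSpace ℝ (Fin d)
  theta : EuclideanSpace ℝ (Fin d)

/-- The Mahalanobis norm `‖x‖_M = √(xᵀ M x)`. -/
def mahalanobisNorm {d : ℕ} (M : Matrix (Fin d) (Fin d) ℝ) (x : EuclideanSpace ℝ (Fin d)) : ℝ :=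
  √(x.ofLp ⬝ᵥ M.mulVec x.ofLp)

/-- The regularized design matrix: `V₀ = lam • I`, `V_t = V_{t-1} + X_t X_tᵀ`, where `X t` is the
context that was chosen in round `t ≥ 1`. -/
def designMatrix {d : ℕ} (lam : ℝ) (X : ℕ → EuclideanSpace ℝ (Fin d)) :
    ℕ → Matrix (Fin d) (Fin d) ℝ
  | 0 => lam • (1 : Matrix (Fin d) (Fin d) ℝ)
  | t + 1 => designMatrix lam X t + Matrix.vecMulVec (X (t + 1)).ofLp (X (t + 1)).ofLp

/-- `W₀ = 0`, `W_t = W_{t-1} + Y_t X_t`. -/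
def responseVec {d : ℕ} (X : ℕ → EuclideanSpace ℝ (Fin d)) (Y : ℕ → ℝ) : ℕ → Fin d → ℝ
  | 0 => 0
  | t + 1 => responseVec X Y t + Y (t + 1) • (X (t + 1)).ofLp

/-- The ridge regression estimate `θ̂_t = V_t⁻¹ W_t`. -/
def ridgeEstimate {d : ℕ} (lam : ℝ) (X : ℕ → EuclideanSpace ℝ (Fin d)) (Y : ℕ → ℝ) (t : ℕ) :
    EuclideanSpace ℝ (Fin d) :=
  WithLp.toLp 2 ((designMatrix lam X t)⁻¹.mulVec (responseVec X Y t))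

/-- The squared confidence radius
`β_t(γ) = (R √(d log ((1 + t L² / lam) / γ)) + √lam S)²`. -/
def confRadius (d : ℕ) (L S R lam : ℝ) (t : ℕ) (γ : ℝ) : ℝ :=
  (R * √(d * Real.log ((1 + t * L ^ 2 / lam) / γ)) + √lam * S) ^ 2

/-- `-log w` for `w ≥ 0`, with the value `+∞` at `w = 0`. -/
def negLog (w : ℝ) : EReal :=
  if w = 0 then ⊤ else ((-Real.log w : ℝ) : EReal)

/-- The index of an arm with squared width `w = β_{t-1}(γ) ‖x‖²_{V_{t-1}⁻¹}` and empirical gap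
`gap`, in the mode that caps the index of the empirically best arm at `log T`:
`min (log T) (-log w)` if the arm is the empirically best one (`isBest`), and `gap² / w - log w`
otherwise.  An arm of width `w = 0` (zero context) has `-log w = +∞`. -/
def armIndex (T : ℕ) (isBest : Prop) (gap w : ℝ) : EReal :=
  open Classical in
  if isBest then min ((Real.log T : ℝ) : EReal) (negLog w)
  else ((gap ^ 2 / w : ℝ) : EReal) + negLog w

namespace Bandit

variable {d : ℕ} {Arm : Type*}

/-- The mean reward `⟨θ*, x_{t,a}⟩` of the arm `a` in round `t`. -/
def mean (B : Bandit d Arm) (t : ℕ) (a : Arm) : ℝ := inner ℝ B.theta (B.ctx t a)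

/-- The largest mean reward in round `t`, `max_{a ∈ 𝒜_t} ⟨θ*, x_{t,a}⟩`. -/
def bestMean (B : Bandit d Arm) (t : ℕ) : ℝ := sSup (B.mean t '' B.arms t)

/-- The empirical mean `μ̂_{t,a} = ⟨θ̂_{t-1}, x_{t,a}⟩` on a history of pulled arms `A 1, A 2, …`
and rewards `Y 1, Y 2, …`. -/
def empMean (B : Bandit d Arm) (lam : ℝ) (A : ℕ → Arm) (Y : ℕ → ℝ) (t : ℕ) (a : Arm) : ℝ :=
  inner ℝ (ridgeEstimate lam (fun s => B.ctx s (A s)) Y (t - 1)) (B.ctx t a)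

/-- The empirical gap `Δ̂_{t,a} = max_{j ∈ 𝒜_t} μ̂_{t,j} - μ̂_{t,a}`. -/
def empGap (B : Bandit d Arm) (lam : ℝ) (A : ℕ → Arm) (Y : ℕ → ℝ) (t : ℕ) (a : Arm) : ℝ :=
  sSup (B.empMean lam A Y t '' B.arms t) - B.empMean lam A Y t a

/-- The squared width `β_{t-1}(γ) ‖x_{t,a}‖²_{V_{t-1}⁻¹}` with `γ = 1 / t²` in round `t`. -/
def width (B : Bandit d Arm) (L S R lam : ℝ) (A : ℕ → Arm) (t : ℕ) (a : Arm) : ℝ :=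
  confRadius d L S R lam (t - 1) (1 / (t : ℝ) ^ 2) *
    mahalanobisNorm (designMatrix lam (fun s => B.ctx s (A s)) (t - 1))⁻¹ (B.ctx t a) ^ 2

/-- The arms with the largest empirical mean in round `t`. -/
def empBest (B : Bandit d Arm) (lam : ℝ) (A : ℕ → Arm) (Y : ℕ → ℝ) (t : ℕ) : Set Arm :=
  {a | a ∈ B.arms t ∧ IsMaxOn (B.empMean lam A Y t) (B.arms t) a}

/-- The arms `A 1, …, A T` are pulled by LinIMED-2 with horizon `T` when it observes the rewards
`Y 1, …, Y T`.  In every round `t` there is an empirically best arm, and the pulled arm minimizes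
the index over `𝒜_t`, with ties broken arbitrarily.  If several arms share the largest empirical
mean, the set `E` of those treated as "the empirically best arm" is an arbitrary nonempty set of
them: `E` may be a single one, chosen by any tie-breaking, or all of them. -/
def IsLinIMED2Run (B : Bandit d Arm) (T : ℕ) (L S R lam : ℝ) (A : ℕ → Arm) (Y : ℕ → ℝ) : Prop :=
  ∀ t ∈ Finset.Icc 1 T, ∃ E : Set Arm, E.Nonempty ∧ E ⊆ B.empBest lam A Y t ∧
    A t ∈ B.arms t ∧ ∀ a ∈ B.arms t,
      armIndex T (A t ∈ E) (B.empGap lam A Y t (A t)) (B.width L S R lam A t (A t)) ≤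
        armIndex T (a ∈ E) (B.empGap lam A Y t a) (B.width L S R lam A t a)

/-- The reward `Y_t = ⟨θ*, X_t⟩ + η_t` in round `t`. -/
def reward {Ω : Type*} (B : Bandit d Arm) (A : ℕ → Ω → Arm) (η : ℕ → Ω → ℝ) (t : ℕ) (ω : Ω) : ℝ :=
  B.mean t (A t ω) + η t ω

/-- The expected cumulative regret `E[∑_{t=1}^T (max_a ⟨θ*, x_{t,a}⟩ - ⟨θ*, X_t⟩)]`. -/
def expectedRegret {Ω : Type*} [MeasurableSpace Ω] (P : Measure Ω) (B : Bandit d Arm)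
    (A : ℕ → Ω → Arm) (T : ℕ) : ℝ :=
  ∫ ω, ∑ t ∈ Finset.Icc 1 T, (B.bestMean t - B.mean t (A t ω)) ∂P

end Bandit

/-- The σ-algebra generated by `A_1, …, A_t, Y_1, …, Y_{t-1}`. -/
abbrev history {Ω Arm : Type*} [MeasurableSpace Arm] (A : ℕ → Ω → Arm) (Y : ℕ → Ω → ℝ) (t : ℕ) :
    MeasurableSpace Ω :=
  (⨆ s ∈ Set.Icc 1 t, MeasurableSpace.comap (A s) inferInstance) ⊔
    (⨆ s ∈ Set.Ico 1 t, MeasurableSpace.comap (Y s) inferInstance)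

/-- `η` is `R`-sub-Gaussian conditionally on `m`: for every real `s`, almost surely
`E[exp (s η) | m] ≤ exp (s² R² / 2)`.  (Integrability of `exp (s η)` is part of the condition, since
`P[f | m] = 0` by convention for a function `f` that is not integrable.) -/
def IsCondSubGaussian {Ω : Type*} [MeasurableSpace Ω] (P : Measure Ω) (m : MeasurableSpace Ω)
    (η : Ω → ℝ) (R : ℝ) : Prop :=
  ∀ s : ℝ, Integrable (fun ω => Real.exp (s * η ω)) P ∧
    ∀ᵐ ω ∂P, (P[fun ω' => Real.exp (s * η ω') | m]) ω ≤ Real.exp (s ^ 2 * R ^ 2 / 2)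

end LinIMED

end

/-!
The regret is controlled round by round on the event that the ridge estimate is accurate, and the
failure of that event is paid for by the bound `1` on the regret of a round.

*Confidence.* With `S_t = ∑_{s ≤ t} η_s X_s`, the process
`exp (‖S_t‖²_{V_t⁻¹} / (2 R²)) / √(det V_t / det V_0)` (`mixture`) is a supermartingale.  Instead
of a `d`-dimensional Gaussian mixture, the proof compares consecutive rounds: by the
Sherman–Morrison formula and the matrix determinant lemma the ratio of two consecutive terms is
the mixture of `exp (s η_t - s² R² / 2)` over a one-dimensional Gaussian in `s` whose mean and
variance are known before `η_t` is drawn (`lintegral_exp_mul_gaussianPDFReal`), and Tonelli's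
theorem reduces its conditional expectation to the sub-Gaussian condition at fixed `s`
(`IsCondSubGaussian.lintegral_mul_mixture_le`).  Markov's inequality gives a failure probability of
`1 / t` in round `t` (`measure_confidence_failure_le`); with `1 / t` in place of `1 / t²` the radius
`β_{t-1}(1 / t²)` suffices in every dimension `d ≥ 1`, and `∑ 1 / t ≤ 1 + log T` is affordable.

*One round.* Let all empirical means be within `√w` of the means.  The pulled arm has index at most
`log T`, so its empirical gap is at most `√(w log T)` if `w ≤ 1`.  Comparing its index with that of
the optimal arm shows that the optimal arm is either empirically worse by more than its own
confidence width, which costs nothing, or its squared width is at most four times that of the pulled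
arm or `4 / T`.  Hence the regret is at most `√w (√(log T) + 3) + 2 / √T`
(`regret_le_of_abs_sub_le`); for `w > 1` the bound `1` on the regret is better.

*Summation.* The radius is of order `d log T`, and the squared widths `‖X_t‖²_{V_{t-1}⁻¹}`,
truncated at `1`, sum to `O(d log T)` (`sum_min_one_potential_le`), so Cauchy–Schwarz gives
`√(d log T) · √(log T) · √(T d log T)`.
-/

namespace LinIMED

open Matrix ProbabilityTheory
open scoped ENNReal

/-! ### Positive definite matrices -/

section PosDef

variable {n : Type*} [Fintype n] {M : Matrix n n ℝ}

theorem _root_.Matrix.IsHermitian.dotProduct_mulVec_comm (hM : M.IsHermitian) (x y : n → ℝ) :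
    x ⬝ᵥ M *ᵥ y = y ⬝ᵥ M *ᵥ x := by
  have h : Mᵀ = M := by simpa using hM.eq
  rw [dotProduct_mulVec, ← mulVec_transpose, h, dotProduct_comm]

theorem _root_.Matrix.PosDef.quad_nonneg (hM : M.PosDef) (x : n → ℝ) : 0 ≤ x ⬝ᵥ M *ᵥ x := by
  simpa using hM.posSemidef.dotProduct_mulVec_nonneg x

theorem _root_.Matrix.PosDef.add_vecMulVec_self (hM : M.PosDef) (x : n → ℝ) :
    (M + vecMulVec x x).PosDef := by
  have := posSemidef_vecMulVec_self_star x
  simp only [star_trivial] at this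
  exact hM.add_posSemidef this

theorem vecMulVec_self_mulVec (x y : n → ℝ) : vecMulVec x x *ᵥ y = (x ⬝ᵥ y) • x := by
  rw [vecMulVec_mulVec]
  simp

variable [DecidableEq n]

theorem _root_.Matrix.PosDef.cauchy_schwarz (hM : M.PosDef) (x y : n → ℝ) :
    |x ⬝ᵥ M *ᵥ y| ≤ √(x ⬝ᵥ M *ᵥ x) * √(y ⬝ᵥ M *ᵥ y) := by
  rw [← Real.sqrt_mul (PosDef.quad_nonneg hM x)]
  apply Real.abs_le_sqrt
  have h := LinearMap.BilinForm.apply_sq_le_of_symm (Matrix.toBilin' M)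
    (fun x => by simpa [Matrix.toBilin'_apply'] using PosDef.quad_nonneg hM x)
    ⟨fun x y => by
      simpa [Matrix.toBilin'_apply'] using IsHermitian.dotProduct_mulVec_comm hM.isHermitian x y⟩ x y
  simpa [Matrix.toBilin'_apply'] using h

theorem _root_.Matrix.PosDef.mulVec_inv_mulVec (hM : M.PosDef) (x : n → ℝ) : M *ᵥ (M⁻¹ *ᵥ x) = x := by
  rw [mulVec_mulVec, mul_nonsing_inv _ ((isUnit_iff_isUnit_det _).1 hM.isUnit), one_mulVec]

theorem _root_.Matrix.PosDef.inv_mulVec_mulVec (hM : M.PosDef) (x : n → ℝ) : M⁻¹ *ᵥ (M *ᵥ x) = x := by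
  rw [mulVec_mulVec, nonsing_inv_mul _ ((isUnit_iff_isUnit_det _).1 hM.isUnit), one_mulVec]

/-- `M ≥ c I` implies `M⁻¹ ≤ c⁻¹ I`. -/
theorem _root_.Matrix.PosDef.inv_quad_le (hM : M.PosDef) {c : ℝ} (hc : 0 < c)
    (h : ∀ y : n → ℝ, c * (y ⬝ᵥ y) ≤ y ⬝ᵥ M *ᵥ y) (x : n → ℝ) :
    x ⬝ᵥ M⁻¹ *ᵥ x ≤ (x ⬝ᵥ x) / c := by
  set y := M⁻¹ *ᵥ x with hy
  have hMy : M *ᵥ y = x := PosDef.mulVec_inv_mulVec hM x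
  have h1 : c * (y ⬝ᵥ y) ≤ x ⬝ᵥ y := by
    have := h y
    rwa [hMy, dotProduct_comm y x] at this
  have h2 : 0 ≤ (x - c • y) ⬝ᵥ (x - c • y) := by
    simpa using dotProduct_star_self_nonneg (x - c • y)
  have h3 : (x - c • y) ⬝ᵥ (x - c • y) = x ⬝ᵥ x - 2 * c * (x ⬝ᵥ y) + c * (c * (y ⬝ᵥ y)) := by
    simp only [sub_dotProduct, dotProduct_sub, smul_dotProduct, dotProduct_smul, smul_eq_mul,
      dotProduct_comm y x]
    ring
  rw [le_div_iff₀ hc]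
  nlinarith [mul_le_mul_of_nonneg_left h1 hc.le]

/-- The Sherman–Morrison formula for the quadratic form of the inverse. -/
theorem _root_.Matrix.PosDef.inv_quad_add_vecMulVec (hM : M.PosDef) (x z : n → ℝ) :
    z ⬝ᵥ (M + vecMulVec x x)⁻¹ *ᵥ z =
      z ⬝ᵥ M⁻¹ *ᵥ z - (x ⬝ᵥ M⁻¹ *ᵥ z) ^ 2 / (1 + x ⬝ᵥ M⁻¹ *ᵥ x) := by
  have hu := PosDef.quad_nonneg hM.inv x
  set y := (M + vecMulVec x x)⁻¹ *ᵥ z with hy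
  have h1 : (M + vecMulVec x x) *ᵥ y = z :=
    PosDef.mulVec_inv_mulVec (PosDef.add_vecMulVec_self hM x) z
  have h2 : y + (x ⬝ᵥ y) • (M⁻¹ *ᵥ x) = M⁻¹ *ᵥ z := by
    rw [← h1, add_mulVec, mulVec_add, PosDef.inv_mulVec_mulVec hM, vecMulVec_self_mulVec,
      mulVec_smul]
  have h3 : x ⬝ᵥ y = (x ⬝ᵥ M⁻¹ *ᵥ z) / (1 + x ⬝ᵥ M⁻¹ *ᵥ x) := by
    rw [← h2, eq_div_iff (by positivity), dotProduct_add, dotProduct_smul, smul_eq_mul]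
    ring
  have h4 : z ⬝ᵥ M⁻¹ *ᵥ z = z ⬝ᵥ y + (x ⬝ᵥ y) * (x ⬝ᵥ M⁻¹ *ᵥ z) := by
    rw [← h2, dotProduct_add, dotProduct_smul, smul_eq_mul, h2,
      IsHermitian.dotProduct_mulVec_comm hM.inv.isHermitian x z]
  rw [h4, h3]
  ring

theorem _root_.Matrix.PosDef.det_add_vecMulVec (hM : M.PosDef) (x : n → ℝ) :
    (M + vecMulVec x x).det = M.det * (1 + x ⬝ᵥ M⁻¹ *ᵥ x) := by
  rw [vecMulVec_eq Unit, det_add_replicateCol_mul_replicateRow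
    ((isUnit_iff_isUnit_det _).1 hM.isUnit)]
  congr 1
  rw [Matrix.mul_assoc, ← replicateCol_mulVec, replicateRow_mul_replicateCol]
  simp

theorem _root_.Matrix.PosDef.det_le_pow (hM : M.PosDef) {c : ℝ}
    (h : ∀ y : n → ℝ, y ⬝ᵥ M *ᵥ y ≤ c * (y ⬝ᵥ y)) : M.det ≤ c ^ Fintype.card n := by
  rw [hM.isHermitian.det_eq_prod_eigenvalues, ← Finset.card_univ, ← Finset.prod_const]
  refine Finset.prod_le_prod (fun i _ => (hM.eigenvalues_pos i).le) fun i _ => ?_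
  have h1 := h (hM.isHermitian.eigenvectorBasis i)
  have h2 : (hM.isHermitian.eigenvectorBasis i).ofLp ⬝ᵥ
      (hM.isHermitian.eigenvectorBasis i).ofLp = 1 := by
    have := hM.isHermitian.eigenvectorBasis.orthonormal.1 i
    rw [EuclideanSpace.norm_eq, Real.sqrt_eq_one] at this
    simpa [dotProduct, sq] using this
  have h3 := hM.isHermitian.eigenvalues_eq i
  simp only [star_trivial, RCLike.re_to_real] at h3
  rw [h2, mul_one, ← h3] at h1
  simpa using h1

end PosDef

/-! ### The design matrix and the elliptical potential -/

section Design

variable {d : ℕ} {lam : ℝ} (X : ℕ → EuclideanSpace ℝ (Fin d))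

theorem designMatrix_posDef (hlam : 0 < lam) (t : ℕ) : (designMatrix lam X t).PosDef := by
  induction t with
  | zero => exact PosDef.one.smul hlam
  | succ t ih => exact PosDef.add_vecMulVec_self ih _

theorem dotProduct_self_eq_norm_sq (x : EuclideanSpace ℝ (Fin d)) :
    x.ofLp ⬝ᵥ x.ofLp = ‖x‖ ^ 2 := by
  rw [EuclideanSpace.real_norm_sq_eq]
  simp [dotProduct, sq]

theorem inner_eq_dotProduct (x y : EuclideanSpace ℝ (Fin d)) :
    inner ℝ x y = x.ofLp ⬝ᵥ y.ofLp := by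
  rw [EuclideanSpace.inner_eq_star_dotProduct, star_trivial, dotProduct_comm]

theorem designMatrix_quad_succ (t : ℕ) (y : Fin d → ℝ) :
    y ⬝ᵥ designMatrix lam X (t + 1) *ᵥ y =
      y ⬝ᵥ designMatrix lam X t *ᵥ y + ((X (t + 1)).ofLp ⬝ᵥ y) ^ 2 := by
  rw [designMatrix, add_mulVec, dotProduct_add, vecMulVec_self_mulVec, dotProduct_smul,
    dotProduct_comm y (X (t + 1)).ofLp, smul_eq_mul, sq]

theorem le_designMatrix_quad (t : ℕ) (y : Fin d → ℝ) :
    lam * (y ⬝ᵥ y) ≤ y ⬝ᵥ designMatrix lam X t *ᵥ y := by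
  induction t with
  | zero => simp [designMatrix, smul_mulVec]
  | succ t ih =>
    rw [designMatrix_quad_succ]
    nlinarith [sq_nonneg ((X (t + 1)).ofLp ⬝ᵥ y)]

theorem designMatrix_quad_le {L : ℝ} (t : ℕ) (hX : ∀ s ∈ Finset.Icc 1 t, ‖X s‖ ≤ L)
    (y : Fin d → ℝ) :
    y ⬝ᵥ designMatrix lam X t *ᵥ y ≤ (lam + t * L ^ 2) * (y ⬝ᵥ y) := by
  induction t with
  | zero => simp [designMatrix, smul_mulVec]
  | succ t ih =>
    have h1 := ih fun s hs => hX s (by simp at hs ⊢; omega)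
    have h2 : ((X (t + 1)).ofLp ⬝ᵥ y) ^ 2 ≤ L ^ 2 * (y ⬝ᵥ y) := by
      have h3 : (inner ℝ (X (t + 1)) (WithLp.toLp 2 y) : ℝ) ^ 2 ≤
          ‖X (t + 1)‖ ^ 2 * ‖WithLp.toLp 2 y‖ ^ 2 := by
        rw [← mul_pow, ← sq_abs]
        gcongr
        exact abs_real_inner_le_norm _ _
      rw [inner_eq_dotProduct, ← dotProduct_self_eq_norm_sq (WithLp.toLp 2 y)] at h3
      refine h3.trans ?_
      have : ‖X (t + 1)‖ ≤ L := hX _ (by simp)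
      have h4 : 0 ≤ y ⬝ᵥ y := by simpa using dotProduct_star_self_nonneg y
      simp only
      gcongr
    rw [designMatrix_quad_succ]
    push_cast
    linarith

theorem det_designMatrix_zero : (designMatrix lam X 0).det = lam ^ d := by
  simp [designMatrix]

theorem det_designMatrix_le {L : ℝ} (hlam : 0 < lam) (t : ℕ)
    (hX : ∀ s ∈ Finset.Icc 1 t, ‖X s‖ ≤ L) :
    (designMatrix lam X t).det ≤ lam ^ d * (1 + t * L ^ 2 / lam) ^ d := by
  have h := PosDef.det_le_pow (designMatrix_posDef X hlam t) (designMatrix_quad_le X t hX)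
  rw [← mul_pow, mul_add, mul_one, mul_div_cancel₀ _ hlam.ne']
  simpa using h

/-- The squared width `‖X_{t+1}‖²_{V_t⁻¹}` of the context chosen in round `t + 1`. -/
noncomputable def potential (lam : ℝ) (X : ℕ → EuclideanSpace ℝ (Fin d)) (t : ℕ) : ℝ :=
  (X (t + 1)).ofLp ⬝ᵥ (designMatrix lam X t)⁻¹ *ᵥ (X (t + 1)).ofLp

theorem potential_nonneg (hlam : 0 < lam) (t : ℕ) : 0 ≤ potential lam X t :=
  PosDef.quad_nonneg (designMatrix_posDef X hlam t).inv _

theorem det_designMatrix_succ (hlam : 0 < lam) (t : ℕ) :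
    (designMatrix lam X (t + 1)).det = (designMatrix lam X t).det * (1 + potential lam X t) :=
  PosDef.det_add_vecMulVec (designMatrix_posDef X hlam t) _

/-- The determinant lemma telescopes: `∑ log (1 + ‖X_{s+1}‖²_{V_s⁻¹}) = log (det V_t / det V_0)`. -/
theorem sum_log_one_add_potential (hlam : 0 < lam) (t : ℕ) :
    ∑ s ∈ Finset.range t, Real.log (1 + potential lam X s) =
      Real.log ((designMatrix lam X t).det / lam ^ d) := by
  induction t with
  | zero => rw [det_designMatrix_zero, div_self (by positivity)]; simp
  | succ t ih =>
    have h1 := (designMatrix_posDef X hlam t).det_pos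
    have h2 := potential_nonneg X hlam t
    rw [Finset.sum_range_succ, ih, det_designMatrix_succ X hlam, mul_div_right_comm,
      Real.log_mul (by positivity) (by positivity)]

/-- The elliptical potential lemma. -/
theorem sum_min_one_potential_le {L : ℝ} (hlam : 0 < lam) (t : ℕ)
    (hX : ∀ s ∈ Finset.Icc 1 t, ‖X s‖ ≤ L) :
    ∑ s ∈ Finset.range t, min 1 (potential lam X s) ≤
      2 * (d * Real.log (1 + t * L ^ 2 / lam)) := by
  have h1 : ∀ s ∈ Finset.range t,
      min 1 (potential lam X s) ≤ 2 * Real.log (1 + potential lam X s) := by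
    intro s _
    have hu := potential_nonneg X hlam s
    set v := min 1 (potential lam X s) with hv
    have hv0 : 0 ≤ v := le_min zero_le_one hu
    have hv1 : v ≤ 1 := min_le_left _ _
    have hvu : v ≤ potential lam X s := min_le_right _ _
    have h2 : Real.log (1 + v) ≤ Real.log (1 + potential lam X s) :=
      Real.log_le_log (by linarith) (by linarith)
    have h3 : 1 - (1 + v)⁻¹ ≤ Real.log (1 + v) := Real.one_sub_inv_le_log_of_pos (by linarith)
    have h4 : v / 2 ≤ 1 - (1 + v)⁻¹ := by
      have : 1 - (1 + v)⁻¹ = v / (1 + v) := by field_simp; ring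
      rw [this]
      gcongr
      linarith
    linarith
  refine (Finset.sum_le_sum h1).trans ?_
  rw [← Finset.mul_sum, sum_log_one_add_potential X hlam, ← Real.log_pow]
  have h5 := (designMatrix_posDef X hlam t).det_pos
  gcongr
  rw [div_le_iff₀' (by positivity)]
  exact det_designMatrix_le X hlam t hX

/-! ### The ridge regression estimate -/

/-- The squared self-normalized norm `‖S_t‖²_{V_t⁻¹}` of the noise sum `S_t = ∑_{s ≤ t} η_s X_s`. -/
noncomputable def noiseNormSq (lam : ℝ) (X : ℕ → EuclideanSpace ℝ (Fin d)) (η : ℕ → ℝ) (t : ℕ) : ℝ :=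
  responseVec X η t ⬝ᵥ (designMatrix lam X t)⁻¹ *ᵥ responseVec X η t

theorem noiseNormSq_succ (hlam : 0 < lam) (η : ℕ → ℝ) (t : ℕ) :
    noiseNormSq lam X η (t + 1) = noiseNormSq lam X η t +
      (2 * η (t + 1) * ((X (t + 1)).ofLp ⬝ᵥ (designMatrix lam X t)⁻¹ *ᵥ responseVec X η t) +
        η (t + 1) ^ 2 * potential lam X t -
        ((X (t + 1)).ofLp ⬝ᵥ (designMatrix lam X t)⁻¹ *ᵥ responseVec X η t) ^ 2) /
        (1 + potential lam X t) := by
  have hV := designMatrix_posDef X hlam t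
  have hu := potential_nonneg X hlam t
  rw [noiseNormSq, noiseNormSq, designMatrix, responseVec, PosDef.inv_quad_add_vecMulVec hV]
  simp only [mulVec_add, dotProduct_add, add_dotProduct, mulVec_smul, dotProduct_smul,
    smul_dotProduct, smul_eq_mul]
  rw [IsHermitian.dotProduct_mulVec_comm hV.inv.isHermitian (responseVec X η t) (X (t + 1)).ofLp]
  change _ + _ + _ * (_ + _ * potential lam X t) -
    (_ + _ * potential lam X t) ^ 2 / (1 + potential lam X t) = _
  have : (1 + potential lam X t) ≠ 0 := by positivity
  field_simp
  ring

/-- `W_t = V_t θ + (S_t - lam θ)`: the regularization enters as an additional bias term. -/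
theorem responseVec_eq (θ : EuclideanSpace ℝ (Fin d)) (Y η : ℕ → ℝ) (t : ℕ)
    (hY : ∀ s, Y s = inner ℝ θ (X s) + η s) :
    responseVec X Y t =
      designMatrix lam X t *ᵥ θ.ofLp + (responseVec X η t - lam • θ.ofLp) := by
  induction t with
  | zero => simp [responseVec, designMatrix, smul_mulVec]
  | succ t ih =>
    rw [responseVec, responseVec, designMatrix, ih, hY, add_mulVec, vecMulVec_self_mulVec,
      inner_eq_dotProduct, dotProduct_comm θ.ofLp, add_smul]
    abel

/-- The error of the ridge estimate in a direction `x` is at most the Mahalanobis norm of `x`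
times the noise norm plus the regularization bias. -/
theorem abs_inner_ridgeEstimate_sub_le (hlam : 0 < lam) {θ : EuclideanSpace ℝ (Fin d)} {S : ℝ}
    (hθ : ‖θ‖ ≤ S) {Y η : ℕ → ℝ} (hY : ∀ s, Y s = inner ℝ θ (X s) + η s) (t : ℕ)
    (x : EuclideanSpace ℝ (Fin d)) :
    |inner ℝ (ridgeEstimate lam X Y t) x - inner ℝ θ x| ≤
      (√(noiseNormSq lam X η t) + √lam * S) * mahalanobisNorm (designMatrix lam X t)⁻¹ x := by
  have hV := designMatrix_posDef X hlam t
  have h1 : (inner ℝ (ridgeEstimate lam X Y t) x - inner ℝ θ x : ℝ) =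
      x.ofLp ⬝ᵥ (designMatrix lam X t)⁻¹ *ᵥ responseVec X η t -
        lam * (x.ofLp ⬝ᵥ (designMatrix lam X t)⁻¹ *ᵥ θ.ofLp) := by
    rw [inner_eq_dotProduct, inner_eq_dotProduct, ridgeEstimate, responseVec_eq X θ Y η t hY
      (lam := lam), mulVec_add, PosDef.inv_mulVec_mulVec hV, add_dotProduct, mulVec_sub,
      sub_dotProduct, mulVec_smul, smul_dotProduct, smul_eq_mul, dotProduct_comm _ x.ofLp,
      dotProduct_comm _ x.ofLp]
    simp only [dotProduct_comm _ x.ofLp]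
    ring
  have h2 := PosDef.cauchy_schwarz hV.inv x.ofLp (responseVec X η t)
  have h3 := PosDef.cauchy_schwarz hV.inv x.ofLp θ.ofLp
  have h4 : lam * √(θ.ofLp ⬝ᵥ (designMatrix lam X t)⁻¹ *ᵥ θ.ofLp) ≤ √lam * S := by
    have h5 := PosDef.inv_quad_le hV hlam (le_designMatrix_quad X t) θ.ofLp
    have h6 : √(θ.ofLp ⬝ᵥ (designMatrix lam X t)⁻¹ *ᵥ θ.ofLp) ≤ S / √lam := by
      have hS : 0 ≤ S := (norm_nonneg _).trans hθ
      rw [Real.sqrt_le_left (by positivity), div_pow, Real.sq_sqrt hlam.le]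
      refine h5.trans ?_
      rw [dotProduct_self_eq_norm_sq]
      gcongr
    calc _ ≤ lam * (S / √lam) := by gcongr
      _ = √lam * S := by
        nth_rewrite 1 [← Real.mul_self_sqrt hlam.le]
        field_simp
  have h7 := Real.sqrt_nonneg (x.ofLp ⬝ᵥ (designMatrix lam X t)⁻¹ *ᵥ x.ofLp)
  rw [h1, mahalanobisNorm]
  refine (abs_sub _ _).trans ?_
  rw [abs_mul, abs_of_pos hlam, noiseNormSq]
  nlinarith [mul_le_mul_of_nonneg_left h4 h7, mul_le_mul_of_nonneg_left h3 hlam.le]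

theorem mahalanobisNorm_sq (hlam : 0 < lam) (t : ℕ) (x : EuclideanSpace ℝ (Fin d)) :
    mahalanobisNorm (designMatrix lam X t)⁻¹ x ^ 2 =
      x.ofLp ⬝ᵥ (designMatrix lam X t)⁻¹ *ᵥ x.ofLp :=
  Real.sq_sqrt (PosDef.quad_nonneg (designMatrix_posDef X hlam t).inv _)

end Design

/-! ### Conditional sub-Gaussian noise and Gaussian mixtures -/

/-- The Gaussian mixture `N(b / R², u / R²)` of the sub-Gaussian exponentials
`exp (s η - s² R² / 2)`, by completing the square: the integrand is a constant multiple of the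
posterior density `N((b + u η) / (R² (1 + u)), u / (R² (1 + u)))` of `s`. -/
theorem lintegral_exp_mul_gaussianPDFReal {R u : ℝ} (hR : 0 < R) (hu : 0 < u) (b η : ℝ) :
    ∫⁻ s, ENNReal.ofReal (Real.exp (s * η - s ^ 2 * R ^ 2 / 2) *
      gaussianPDFReal (b / R ^ 2) (u / R ^ 2).toNNReal s) =
      ENNReal.ofReal (Real.exp ((2 * η * b + η ^ 2 * u - b ^ 2) / (1 + u) / (2 * R ^ 2)) /
        √(1 + u)) := by
  have hv : 0 < u / (R ^ 2 * (1 + u)) := by positivity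
  have hv' : (u / (R ^ 2 * (1 + u))).toNNReal ≠ 0 := by simpa using hv
  have key : ∀ s : ℝ, Real.exp (s * η - s ^ 2 * R ^ 2 / 2) *
      gaussianPDFReal (b / R ^ 2) (u / R ^ 2).toNNReal s =
      (Real.exp ((2 * η * b + η ^ 2 * u - b ^ 2) / (1 + u) / (2 * R ^ 2)) / √(1 + u)) *
        gaussianPDFReal ((b + u * η) / (R ^ 2 * (1 + u))) (u / (R ^ 2 * (1 + u))).toNNReal s := by
    intro s
    simp only [gaussianPDFReal]
    rw [Real.coe_toNNReal _ hv.le, Real.coe_toNNReal _ (by positivity)]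
    have h1 : √(2 * Real.pi * (u / R ^ 2)) =
        √(2 * Real.pi * (u / (R ^ 2 * (1 + u)))) * √(1 + u) := by
      rw [← Real.sqrt_mul (by positivity)]
      congr 1
      field_simp
    have h2 : Real.exp (s * η - s ^ 2 * R ^ 2 / 2) *
        Real.exp (-(s - b / R ^ 2) ^ 2 / (2 * (u / R ^ 2))) =
        Real.exp ((2 * η * b + η ^ 2 * u - b ^ 2) / (1 + u) / (2 * R ^ 2)) *
        Real.exp (-(s - (b + u * η) / (R ^ 2 * (1 + u))) ^ 2 / (2 * (u / (R ^ 2 * (1 + u))))) := by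
      rw [← Real.exp_add, ← Real.exp_add]
      congr 1
      field_simp
      ring
    rw [h1, mul_inv]
    calc _ = (√(2 * Real.pi * (u / (R ^ 2 * (1 + u)))))⁻¹ * (√(1 + u))⁻¹ *
          (Real.exp (s * η - s ^ 2 * R ^ 2 / 2) *
            Real.exp (-(s - b / R ^ 2) ^ 2 / (2 * (u / R ^ 2)))) := by ring
      _ = _ := by rw [h2]; ring
  simp_rw [key]
  simp_rw [fun s => ENNReal.ofReal_mul (q := gaussianPDFReal ((b + u * η) / (R ^ 2 * (1 + u)))
    (u / (R ^ 2 * (1 + u))).toNNReal s)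
    (show 0 ≤ Real.exp ((2 * η * b + η ^ 2 * u - b ^ 2) / (1 + u) / (2 * R ^ 2)) / √(1 + u) by
      positivity)]
  rw [lintegral_const_mul _ (by fun_prop), lintegral_gaussianPDFReal_eq_one _ hv', mul_one]

section Conditional

variable {Ω : Type*} {m m0 : MeasurableSpace Ω} {P : Measure Ω} [IsProbabilityMeasure P]

/-- The conditional sub-Gaussian bound, integrated against a nonnegative weight that is measurable
with respect to the conditioning σ-algebra. -/
theorem IsCondSubGaussian.lintegral_mul_exp_le (hm : m ≤ m0) {η : Ω → ℝ} {R : ℝ}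
    (h : IsCondSubGaussian P m η R) (hη : Measurable η) {g : Ω → ℝ≥0∞} (hg : Measurable[m] g)
    (s : ℝ) :
    ∫⁻ ω, g ω * ENNReal.ofReal (Real.exp (s * η ω - s ^ 2 * R ^ 2 / 2)) ∂P ≤ ∫⁻ ω, g ω ∂P := by
  obtain ⟨hint, hle⟩ := h s
  set f : Ω → ℝ≥0∞ := fun ω => ENNReal.ofReal (Real.exp (s * η ω - s ^ 2 * R ^ 2 / 2)) with hf
  have hfm : Measurable f := by fun_prop
  -- On `m`, the measure with density `exp (s η - s² R² / 2)` is dominated by `P`.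
  have hmeas : (P.withDensity f).trim hm ≤ P.trim hm := by
    refine @Measure.le_intro Ω m _ _ fun A hA _ => ?_
    rw [trim_measurableSet_eq hm hA, trim_measurableSet_eq hm hA, withDensity_apply _ (hm A hA)]
    have hexp : ∀ ω, Real.exp (s * η ω - s ^ 2 * R ^ 2 / 2) =
        (Real.exp (s ^ 2 * R ^ 2 / 2))⁻¹ * Real.exp (s * η ω) := by
      intro ω
      rw [← Real.exp_neg, ← Real.exp_add]
      ring_nf
    have hint' : Integrable (fun ω => Real.exp (s * η ω - s ^ 2 * R ^ 2 / 2)) P := by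
      simp_rw [hexp]
      exact hint.const_mul _
    rw [hf, ← ofReal_integral_eq_lintegral_ofReal hint'.integrableOn
      (ae_of_all _ fun _ => (Real.exp_pos _).le)]
    rw [← ofReal_measureReal]
    apply ENNReal.ofReal_le_ofReal
    simp_rw [hexp]
    rw [integral_const_mul, ← setIntegral_condExp hm hint hA, inv_mul_le_iff₀ (Real.exp_pos _)]
    calc _ ≤ ∫ _ in A, Real.exp (s ^ 2 * R ^ 2 / 2) ∂P := by
          refine integral_mono_ae integrable_condExp.integrableOn (integrable_const _) ?_
          exact ae_restrict_of_ae hle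
      _ = _ := by simp [mul_comm]
  calc ∫⁻ ω, g ω * f ω ∂P = ∫⁻ ω, g ω ∂(P.withDensity f) := by
        rw [lintegral_withDensity_eq_lintegral_mul _ hfm (hg.mono hm le_rfl)]
        simp [mul_comm]
    _ = ∫⁻ ω, g ω ∂((P.withDensity f).trim hm) := (lintegral_trim hm hg).symm
    _ ≤ ∫⁻ ω, g ω ∂(P.trim hm) := lintegral_mono' hmeas le_rfl
    _ = ∫⁻ ω, g ω ∂P := lintegral_trim hm hg

/-- One step of the method of mixtures: with `m`-measurable mixture parameters `b`, `u`, the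
mixture of the sub-Gaussian exponentials has conditional expectation at most one.  Where `u = 0`,
the mixture degenerates and the factor is identically one. -/
theorem IsCondSubGaussian.lintegral_mul_mixture_le (hm : m ≤ m0) {η : Ω → ℝ} {R : ℝ} (hR : 0 < R)
    (h : IsCondSubGaussian P m η R) (hη : Measurable η) {g : Ω → ℝ≥0∞} (hg : Measurable[m] g)
    {b u : Ω → ℝ} (hb : Measurable[m] b) (hu : Measurable[m] u) (hu0 : ∀ ω, 0 ≤ u ω)
    (hbu : ∀ ω, u ω = 0 → b ω = 0) :
    ∫⁻ ω, g ω * ENNReal.ofReal (Real.exp ((2 * η ω * b ω + η ω ^ 2 * u ω - b ω ^ 2) / (1 + u ω) /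
      (2 * R ^ 2)) / √(1 + u ω)) ∂P ≤ ∫⁻ ω, g ω ∂P := by
  set Z : Set Ω := {ω | u ω = 0} with hZ
  have hZm : MeasurableSet[m] Z := hu (measurableSet_singleton 0)
  have hZ0 : MeasurableSet Z := hm _ hZm
  rw [← lintegral_add_compl _ hZ0, ← lintegral_add_compl g hZ0]
  gcongr ?_ + ?_
  · refine (setLIntegral_congr_fun hZ0 fun ω hω => ?_).le
    have h1 : u ω = 0 := hω
    simp [h1, hbu ω h1]
  have hb' := hb.mono hm le_rfl
  have hu' := hu.mono hm le_rfl
  have hg' := hg.mono hm le_rfl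
  set p : Ω → ℝ → ℝ := fun ω s => gaussianPDFReal (b ω / R ^ 2) (u ω / R ^ 2).toNNReal s with hp
  have hpm : Measurable (Function.uncurry p) :=
    measurable_uncurry_gaussianPDFReal.comp
      (f := fun q : Ω × ℝ => (b q.1 / R ^ 2, (u q.1 / R ^ 2).toNNReal, q.2)) (by fun_prop)
  have hpm' : ∀ s, Measurable[m] fun ω => p ω s := fun s =>
    measurable_uncurry_gaussianPDFReal.comp
      (f := fun ω : Ω => (b ω / R ^ 2, (u ω / R ^ 2).toNNReal, s))
      (by fun_prop)
  have hpos : ∀ ω, ω ∈ Zᶜ → (u ω / R ^ 2).toNNReal ≠ 0 := fun ω hω => by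
    have : 0 < u ω := lt_of_le_of_ne (hu0 ω) (Ne.symm hω)
    have : 0 < u ω / R ^ 2 := by positivity
    simpa using this
  calc _ = ∫⁻ ω in Zᶜ, (∫⁻ s, g ω * ENNReal.ofReal (p ω s) *
        ENNReal.ofReal (Real.exp (s * η ω - s ^ 2 * R ^ 2 / 2))) ∂P := by
        refine setLIntegral_congr_fun hZ0.compl fun ω hω => ?_
        have : 0 < u ω := lt_of_le_of_ne (hu0 ω) (Ne.symm hω)
        rw [← lintegral_exp_mul_gaussianPDFReal hR this, ← lintegral_const_mul _ (by fun_prop)]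
        refine lintegral_congr fun s => ?_
        rw [mul_comm (Real.exp _), ENNReal.ofReal_mul (gaussianPDFReal_nonneg _ _ _), mul_assoc]
    _ = ∫⁻ ω, (∫⁻ s, Zᶜ.indicator g ω * ENNReal.ofReal (p ω s) *
        ENNReal.ofReal (Real.exp (s * η ω - s ^ 2 * R ^ 2 / 2))) ∂P := by
        rw [← lintegral_indicator hZ0.compl]
        refine lintegral_congr fun ω => ?_
        by_cases hω : ω ∈ Zᶜ <;> simp [hω]
    _ = ∫⁻ s, ∫⁻ ω, Zᶜ.indicator g ω * ENNReal.ofReal (p ω s) *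
        ENNReal.ofReal (Real.exp (s * η ω - s ^ 2 * R ^ 2 / 2)) ∂P := by
        refine lintegral_lintegral_swap (Measurable.aemeasurable ?_)
        refine Measurable.mul (Measurable.mul ?_ ?_) ?_
        · exact (hg'.indicator hZ0.compl).comp measurable_fst
        · exact hpm.ennreal_ofReal
        · fun_prop
    _ ≤ ∫⁻ s, ∫⁻ ω, Zᶜ.indicator g ω * ENNReal.ofReal (p ω s) ∂P := by
        refine lintegral_mono fun s => ?_
        exact h.lintegral_mul_exp_le hm hη
          ((hg.indicator hZm.compl).mul (hpm' s).ennreal_ofReal) s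
    _ = ∫⁻ ω, (∫⁻ s, Zᶜ.indicator g ω * ENNReal.ofReal (p ω s)) ∂P := by
        refine (lintegral_lintegral_swap (Measurable.aemeasurable ?_)).symm
        exact ((hg'.indicator hZ0.compl).comp measurable_fst).mul hpm.ennreal_ofReal
    _ = ∫⁻ ω, Zᶜ.indicator g ω ∂P := by
        refine lintegral_congr fun ω => ?_
        rw [lintegral_const_mul _ (by fun_prop)]
        by_cases hω : ω ∈ Zᶜ
        · rw [lintegral_gaussianPDFReal_eq_one _ (hpos ω hω), mul_one]
        · simp [hω]
    _ = ∫⁻ ω in Zᶜ, g ω ∂P := lintegral_indicator hZ0.compl _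

/-- Sub-Gaussian noise with parameter `R = 0` vanishes almost surely. -/
theorem IsCondSubGaussian.ae_eq_zero (hm : m ≤ m0) {η : Ω → ℝ}
    (h : IsCondSubGaussian P m η 0) : ∀ᵐ ω ∂P, η ω = 0 := by
  have hbound : ∀ s : ℝ, ∫ ω, Real.exp (s * η ω) ∂P ≤ 1 := by
    intro s
    obtain ⟨hint, hle⟩ := h s
    rw [← integral_condExp hm]
    calc _ ≤ ∫ _, (1 : ℝ) ∂P := by
          refine integral_mono_ae integrable_condExp (integrable_const _) ?_
          filter_upwards [hle] with ω hω
          simpa using hω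
      _ = 1 := by simp
  have hnn : ∀ ω, 0 ≤ Real.exp (1 * η ω) + Real.exp (-1 * η ω) - 2 := by
    intro ω
    have := Real.one_le_cosh (η ω)
    rw [Real.cosh_eq] at this
    simp only [one_mul, neg_mul]
    linarith
  have hint : Integrable (fun ω => Real.exp (1 * η ω) + Real.exp (-1 * η ω) - 2) P :=
    ((h 1).1.add (h (-1)).1).sub (integrable_const _)
  have hzero : ∫ ω, (Real.exp (1 * η ω) + Real.exp (-1 * η ω) - 2) ∂P = 0 := by
    refine le_antisymm ?_ (integral_nonneg hnn)
    have hadd : Integrable (fun ω => Real.exp (1 * η ω) + Real.exp (-1 * η ω)) P :=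
      (h 1).1.add (h (-1)).1
    rw [integral_sub hadd (integrable_const _), integral_add (h 1).1 (h (-1)).1]
    have h1 := hbound 1
    have h2 := hbound (-1)
    rw [integral_const, probReal_univ, smul_eq_mul, one_mul]
    linarith
  filter_upwards [(integral_eq_zero_iff_of_nonneg hnn hint).1 hzero] with ω hω
  by_contra hne
  have := Real.one_lt_cosh.2 hne
  rw [Real.cosh_eq] at this
  simp only [one_mul, neg_mul, Pi.zero_apply] at hω
  linarith

end Conditional

/-! ### The self-normalized tail bound -/

section Measurability

variable {Ω : Type*} [MeasurableSpace Ω] {d : ℕ}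

theorem measurable_ofLp_apply {x : Ω → EuclideanSpace ℝ (Fin d)} (hx : Measurable x) (i : Fin d) :
    Measurable fun ω => (x ω).ofLp i := by
  fun_prop

theorem measurable_designMatrix {X : ℕ → Ω → EuclideanSpace ℝ (Fin d)} (lam : ℝ) {t : ℕ}
    (hX : ∀ s ∈ Finset.Icc 1 t, Measurable (X s)) (i j : Fin d) :
    Measurable fun ω => designMatrix lam (fun s => X s ω) t i j := by
  induction t with
  | zero => simp only [designMatrix]; fun_prop
  | succ t ih =>
    have h1 := ih fun s hs => hX s (by simp at hs ⊢; omega)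
    have h2 : Measurable (X (t + 1)) := hX _ (by simp)
    simp only [designMatrix, Matrix.add_apply, vecMulVec_apply]
    fun_prop

theorem measurable_responseVec {X : ℕ → Ω → EuclideanSpace ℝ (Fin d)} {η : ℕ → Ω → ℝ} {t : ℕ}
    (hX : ∀ s ∈ Finset.Icc 1 t, Measurable (X s)) (hη : ∀ s ∈ Finset.Icc 1 t, Measurable (η s))
    (i : Fin d) :
    Measurable fun ω => responseVec (fun s => X s ω) (fun s => η s ω) t i := by
  induction t with
  | zero => simp only [responseVec]; fun_prop
  | succ t ih =>
    have h1 := ih (fun s hs => hX s (by simp at hs ⊢; omega))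
      fun s hs => hη s (by simp at hs ⊢; omega)
    have h2 : Measurable (X (t + 1)) := hX _ (by simp)
    have h3 : Measurable (η (t + 1)) := hη _ (by simp)
    simp only [responseVec, Pi.add_apply, Pi.smul_apply, smul_eq_mul]
    fun_prop

theorem measurable_det {M : Ω → Matrix (Fin d) (Fin d) ℝ}
    (hM : ∀ i j, Measurable fun ω => M ω i j) : Measurable fun ω => (M ω).det := by
  simp only [Matrix.det_apply']
  fun_prop

theorem measurable_inv_apply {M : Ω → Matrix (Fin d) (Fin d) ℝ}
    (hM : ∀ i j, Measurable fun ω => M ω i j) (i j : Fin d) :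
    Measurable fun ω => (M ω)⁻¹ i j := by
  simp only [Matrix.inv_def, Matrix.smul_apply, Matrix.adjugate_apply, Ring.inverse_eq_inv',
    smul_eq_mul]
  refine (measurable_det hM).inv.mul (measurable_det fun k l => ?_)
  by_cases h : k = j
  · subst h
    simp
  · simpa [Matrix.updateRow_ne h] using hM k l

theorem measurable_dotProduct_mulVec {M : Ω → Matrix (Fin d) (Fin d) ℝ} {x y : Ω → Fin d → ℝ}
    (hM : ∀ i j, Measurable fun ω => M ω i j) (hx : ∀ i, Measurable fun ω => x ω i)
    (hy : ∀ i, Measurable fun ω => y ω i) :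
    Measurable fun ω => x ω ⬝ᵥ M ω *ᵥ y ω := by
  simp only [dotProduct, mulVec]
  fun_prop

end Measurability

/-- The mixture supermartingale `exp (‖S_t‖²_{V_t⁻¹} / (2 R²)) / √(det V_t / det V_0)`. -/
noncomputable def mixture {d : ℕ} (lam R : ℝ) (X : ℕ → EuclideanSpace ℝ (Fin d)) (η : ℕ → ℝ)
    (t : ℕ) : ℝ :=
  Real.exp (noiseNormSq lam X η t / (2 * R ^ 2)) / √((designMatrix lam X t).det / lam ^ d)

theorem mixture_nonneg {d : ℕ} (lam R : ℝ) (X : ℕ → EuclideanSpace ℝ (Fin d)) (η : ℕ → ℝ)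
    (t : ℕ) : 0 ≤ mixture lam R X η t := by
  unfold mixture; positivity

theorem mixture_succ {d : ℕ} {lam : ℝ} (hlam : 0 < lam) (R : ℝ)
    (X : ℕ → EuclideanSpace ℝ (Fin d)) (η : ℕ → ℝ) (t : ℕ) :
    mixture lam R X η (t + 1) = mixture lam R X η t *
      (Real.exp ((2 * η (t + 1) *
          ((X (t + 1)).ofLp ⬝ᵥ (designMatrix lam X t)⁻¹ *ᵥ responseVec X η t) +
        η (t + 1) ^ 2 * potential lam X t -
        ((X (t + 1)).ofLp ⬝ᵥ (designMatrix lam X t)⁻¹ *ᵥ responseVec X η t) ^ 2) /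
        (1 + potential lam X t) / (2 * R ^ 2)) / √(1 + potential lam X t)) := by
  have h1 := (designMatrix_posDef X hlam t).det_pos
  rw [mixture, noiseNormSq_succ X hlam, det_designMatrix_succ X hlam, mul_div_right_comm,
    Real.sqrt_mul (by positivity), add_div, Real.exp_add, mixture]
  ring

section Tail

variable {Ω : Type*} {m0 : MeasurableSpace Ω} {P : Measure Ω} [IsProbabilityMeasure P] {d : ℕ}
  {lam R : ℝ} {X : ℕ → Ω → EuclideanSpace ℝ (Fin d)} {η : ℕ → Ω → ℝ} {m : ℕ → MeasurableSpace Ω}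
  {T : ℕ}

/-- The mixture has expectation at most one.  `m t` is the information available when the noise of
round `t` is drawn: the contexts up to round `t` and the noise of earlier rounds. -/
theorem lintegral_mixture_le_one (hlam : 0 < lam) (hR : 0 < R)
    (hm : ∀ t ∈ Finset.Icc 1 T, m t ≤ m0)
    (hX : ∀ t ∈ Finset.Icc 1 T, ∀ s ∈ Finset.Icc 1 t, Measurable[m t] (X s))
    (hη : ∀ t ∈ Finset.Icc 1 T, ∀ s ∈ Finset.Ico 1 t, Measurable[m t] (η s))
    (hη0 : ∀ t ∈ Finset.Icc 1 T, Measurable (η t))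
    (hsub : ∀ t ∈ Finset.Icc 1 T, IsCondSubGaussian P (m t) (η t) R) {t : ℕ} (ht : t ≤ T) :
    ∫⁻ ω, ENNReal.ofReal (mixture lam R (fun s => X s ω) (fun s => η s ω) t) ∂P ≤ 1 := by
  induction t with
  | zero =>
    have : lam ^ d ≠ 0 := by positivity
    simp [mixture, noiseNormSq, responseVec, designMatrix, this]
  | succ t ih =>
    refine le_trans ?_ (ih (by omega))
    have htT : t + 1 ∈ Finset.Icc 1 T := by simp; omega
    simp_rw [mixture_succ hlam, ENNReal.ofReal_mul (mixture_nonneg _ _ _ _ _)]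
    have hX' : ∀ s ∈ Finset.Icc 1 t, Measurable[m (t + 1)] (X s) := fun s hs =>
      hX _ htT s (by simp at hs ⊢; omega)
    have hη' : ∀ s ∈ Finset.Icc 1 t, Measurable[m (t + 1)] (η s) := fun s hs =>
      hη _ htT s (by simp at hs ⊢; omega)
    have hXt : Measurable[m (t + 1)] (X (t + 1)) := hX _ htT _ (by simp)
    have hV := @measurable_designMatrix Ω (m (t + 1)) d X lam t hX'
    have hVi := @measurable_inv_apply Ω (m (t + 1)) d _ hV
    have hS := @measurable_responseVec Ω (m (t + 1)) d X η t hX' hη'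
    have hXi := fun i => @measurable_ofLp_apply Ω (m (t + 1)) d _ hXt i
    refine (hsub _ htT).lintegral_mul_mixture_le (hm _ htT) hR (hη0 _ htT) ?_ ?_ ?_
      (fun ω => potential_nonneg _ hlam t) ?_
    · refine Measurable.ennreal_ofReal ?_
      have hQ : Measurable[m (t + 1)] fun ω =>
          noiseNormSq lam (fun s => X s ω) (fun s => η s ω) t :=
        @measurable_dotProduct_mulVec Ω (m (t + 1)) d _ _ _ hVi hS hS
      have hD := @measurable_det Ω (m (t + 1)) d _ hV
      exact (hQ.div_const _).exp.div (hD.div_const _).sqrt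
    · exact @measurable_dotProduct_mulVec Ω (m (t + 1)) d _ _ _ hVi hXi hS
    · exact @measurable_dotProduct_mulVec Ω (m (t + 1)) d _ _ _ hVi hXi hXi
    · -- Where `‖X_{t+1}‖_{V_t⁻¹} = 0`, the cross term vanishes by Cauchy–Schwarz.
      intro ω hω
      have h := PosDef.cauchy_schwarz (designMatrix_posDef (fun s => X s ω) hlam t).inv
        (X (t + 1) ω).ofLp (responseVec (fun s => X s ω) (fun s => η s ω) t)
      change _ ≤ √(potential lam (fun s => X s ω) t) * _ at h
      rw [hω, Real.sqrt_zero, zero_mul] at h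
      exact abs_nonpos_iff.1 h

theorem responseVec_eq_zero {X : ℕ → EuclideanSpace ℝ (Fin d)} {η : ℕ → ℝ} {t : ℕ}
    (h : ∀ s ∈ Finset.Icc 1 t, η s = 0) : responseVec X η t = 0 := by
  induction t with
  | zero => rfl
  | succ t ih =>
    rw [responseVec, ih fun s hs => h s (by simp at hs ⊢; omega), h (t + 1) (by simp)]
    simp

/-- The self-normalized tail bound at a fixed time. -/
theorem measure_lt_noiseNormSq_le (hlam : 0 < lam) (hR : 0 ≤ R)
    (hm : ∀ t ∈ Finset.Icc 1 T, m t ≤ m0)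
    (hX : ∀ t ∈ Finset.Icc 1 T, ∀ s ∈ Finset.Icc 1 t, Measurable[m t] (X s))
    (hη : ∀ t ∈ Finset.Icc 1 T, ∀ s ∈ Finset.Ico 1 t, Measurable[m t] (η s))
    (hη0 : ∀ t ∈ Finset.Icc 1 T, Measurable (η t))
    (hsub : ∀ t ∈ Finset.Icc 1 T, IsCondSubGaussian P (m t) (η t) R) {t : ℕ} (ht : t ≤ T)
    {δ : ℝ} (hδ : 0 < δ) :
    P {ω | R ^ 2 * (Real.log ((designMatrix lam (fun s => X s ω) t).det / lam ^ d) +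
        2 * Real.log (1 / δ)) < noiseNormSq lam (fun s => X s ω) (fun s => η s ω) t} ≤
      ENNReal.ofReal δ := by
  rcases hR.eq_or_lt with rfl | hR
  · have hae : ∀ᵐ ω ∂P, ∀ s ∈ Finset.Icc 1 t, η s ω = 0 := by
      refine (ae_ball_iff (Finset.countable_toSet (Finset.Icc 1 t))).2 fun s hs => ?_
      have hs' : s ∈ Finset.Icc 1 T := by simp at hs ⊢; omega
      exact (hsub s hs').ae_eq_zero (hm s hs')
    refine le_trans (le_of_eq ?_) zero_le
    rw [measure_eq_zero_iff_ae_notMem]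
    filter_upwards [hae] with ω hω
    simp [noiseNormSq, responseVec_eq_zero hω]
  · have hmark := lintegral_mixture_le_one hlam hR hm hX hη hη0 hsub ht
    have hmeas : Measurable fun ω =>
        ENNReal.ofReal (mixture lam R (fun s => X s ω) (fun s => η s ω) t) := by
      have hX' : ∀ s ∈ Finset.Icc 1 t, Measurable (X s) := fun s hs => by
        have hs' : s ∈ Finset.Icc 1 T := by simp at hs ⊢; omega
        exact (hX s hs' s (by simp at hs ⊢; omega)).mono (hm s hs') le_rfl
      have hη' : ∀ s ∈ Finset.Icc 1 t, Measurable (η s) := fun s hs =>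
        hη0 s (by simp at hs ⊢; omega)
      have hV := measurable_designMatrix lam hX'
      have hS := measurable_responseVec hX' hη'
      have hQ : Measurable fun ω => noiseNormSq lam (fun s => X s ω) (fun s => η s ω) t :=
        measurable_dotProduct_mulVec (measurable_inv_apply hV) hS hS
      exact ((hQ.div_const _).exp.div ((measurable_det hV).div_const _).sqrt).ennreal_ofReal
    have h1 := mul_meas_ge_le_lintegral (μ := P) hmeas (ENNReal.ofReal (1 / δ))
    have h2 : ENNReal.ofReal (1 / δ) * P {ω | ENNReal.ofReal (1 / δ) ≤
        ENNReal.ofReal (mixture lam R (fun s => X s ω) (fun s => η s ω) t)} ≤ 1 := h1.trans hmark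
    have h3 : P {ω | ENNReal.ofReal (1 / δ) ≤
        ENNReal.ofReal (mixture lam R (fun s => X s ω) (fun s => η s ω) t)} ≤
        ENNReal.ofReal δ := by
      rw [one_div, ENNReal.ofReal_inv_of_pos hδ] at h2 ⊢
      rw [mul_comm, ← div_eq_mul_inv] at h2
      have := (ENNReal.div_le_iff (by simpa using hδ) ENNReal.ofReal_ne_top).1 h2
      simpa using this
    refine (measure_mono fun ω hω => ?_).trans h3
    rw [Set.mem_ofPred_eq] at hω ⊢
    apply ENNReal.ofReal_le_ofReal
    have hD : 0 < (designMatrix lam (fun s => X s ω) t).det / lam ^ d :=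
      div_pos (designMatrix_posDef _ hlam t).det_pos (by positivity)
    rw [mixture, le_div_iff₀ (Real.sqrt_pos.2 hD)]
    set D := (designMatrix lam (fun s => X s ω) t).det / lam ^ d
    have h4 : 1 / δ * √D = Real.exp (Real.log (1 / δ) + Real.log D / 2) := by
      rw [Real.exp_add, Real.exp_log (by positivity), ← Real.log_sqrt hD.le,
        Real.exp_log (Real.sqrt_pos.2 hD)]
    rw [h4]
    apply Real.exp_le_exp.2
    rw [le_div_iff₀ (by positivity)]
    nlinarith

end Tail

/-! ### The regret of one round -/

/-- Comparison of the pulled arm (width `w`) with an arm whose empirical gap `g'` is within its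
confidence width `√w'`: its index is at most `1 - log w'`, while that of the pulled arm is at least
`min (log T) (-log w)`, and `e ≤ 4`. -/
theorem le_of_armIndex_le {T : ℕ} {p q : Prop} {g g' w w' : ℝ} (hw : 0 ≤ w) (hw' : 0 < w')
    (hg' : g' ^ 2 ≤ w') (hT : 0 < T)
    (h : armIndex T p g w ≤ armIndex T q g' w') :
    w' ≤ 4 * w ∨ w' ≤ 4 / T := by
  have h1 : armIndex T q g' w' ≤ ((1 - Real.log w' : ℝ) : EReal) := by
    unfold armIndex negLog
    rw [if_neg hw'.ne']
    split_ifs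
    · refine (min_le_right _ _).trans ?_
      exact_mod_cast (by linarith : -Real.log w' ≤ 1 - Real.log w')
    · have : g' ^ 2 / w' ≤ 1 := (div_le_one hw').2 hg'
      exact_mod_cast (by linarith : g' ^ 2 / w' + -Real.log w' ≤ 1 - Real.log w')
  have h2 : min ((Real.log T : ℝ) : EReal) (negLog w) ≤ armIndex T p g w := by
    unfold armIndex
    split_ifs
    · exact le_rfl
    · refine (min_le_right _ _).trans ?_
      have : (0 : EReal) ≤ ((g ^ 2 / w : ℝ) : EReal) := by exact_mod_cast (by positivity)
      exact le_add_of_nonneg_left this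
  have hexp : Real.exp 1 ≤ 4 := by linarith [Real.exp_one_lt_three]
  have key : ∀ x : ℝ, 0 < x → -Real.log x ≤ 1 - Real.log w' → w' ≤ 4 * x := by
    intro x hx hle
    have h4 : Real.log w' ≤ 1 + Real.log x := by linarith
    calc w' ≤ Real.exp (1 + Real.log x) := (Real.log_le_iff_le_exp hw').1 h4
      _ = Real.exp 1 * x := by rw [Real.exp_add, Real.exp_log hx]
      _ ≤ 4 * x := by gcongr
  rcases min_le_iff.1 (h2.trans (h.trans h1)) with h3 | h3
  · right
    have h3' : Real.log T ≤ 1 - Real.log w' := by exact_mod_cast h3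
    have := key (T : ℝ)⁻¹ (by positivity) (by rwa [Real.log_inv, neg_neg])
    rwa [div_eq_mul_inv]
  · left
    unfold negLog at h3
    split_ifs at h3 with h0
    · exact absurd (top_le_iff.1 h3) (EReal.coe_ne_top _)
    · exact key w (lt_of_le_of_ne hw (Ne.symm h0)) (by exact_mod_cast h3)

/-- The cap `log T` on the index of an empirically best arm bounds the empirical gap of any other
arm that is pulled.  A zero context has index `⊤`, so it is never pulled unless empirically best. -/
theorem sq_gap_le_of_armIndex_le {T : ℕ} {p : Prop} {g w g' w' : ℝ} (hw : 0 ≤ w) (hw1 : w ≤ 1)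
    (hp : ¬ p) (h : armIndex T p g w ≤ armIndex T True g' w') :
    g ^ 2 ≤ w * Real.log T := by
  have h1 : armIndex T True g' w' ≤ ((Real.log T : ℝ) : EReal) := by
    unfold armIndex
    rw [if_pos trivial]
    exact min_le_left _ _
  have h2 := h.trans h1
  unfold armIndex negLog at h2
  rw [if_neg hp] at h2
  split_ifs at h2 with h0
  · rw [EReal.coe_add_top] at h2
    exact absurd (top_le_iff.1 h2) (EReal.coe_ne_top _)
  · have h3 : g ^ 2 / w + -Real.log w ≤ Real.log T := by exact_mod_cast h2
    have hwpos : 0 < w := lt_of_le_of_ne hw (Ne.symm h0)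
    have h4 := Real.log_nonpos hw hw1
    have h5 : g ^ 2 / w ≤ Real.log T := by linarith
    rwa [div_le_iff₀' hwpos] at h5

/-- The regret of a round in which all empirical means are within the confidence widths and the
pulled arm has width at most one. -/
theorem regret_le_of_abs_sub_le {Arm : Type*} {T : ℕ} (hT : 0 < T) {arms E : Set Arm}
    {μ μh w : Arm → ℝ} (hw : ∀ a, 0 ≤ w a) (hconf : ∀ a, |μh a - μ a| ≤ √(w a))
    (hE : E.Nonempty) (hEsub : E ⊆ {a | a ∈ arms ∧ IsMaxOn μh arms a}) {a : Arm}
    (hmin : ∀ b ∈ arms, armIndex T (a ∈ E) (sSup (μh '' arms) - μh a) (w a) ≤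
      armIndex T (b ∈ E) (sSup (μh '' arms) - μh b) (w b))
    (hwa : w a ≤ 1) {b : Arm} (hb : b ∈ arms) :
    μ b - μ a ≤ √(w a) * (√(Real.log T) + 3) + 2 / √T := by
  obtain ⟨e, he⟩ := hE
  have hsup : ∀ c ∈ E, sSup (μh '' arms) = μh c := fun c hc =>
    IsGreatest.csSup_eq ⟨⟨c, (hEsub hc).1, rfl⟩, by
      rintro _ ⟨x, hx, rfl⟩
      exact (hEsub hc).2 hx⟩
  have hgap : ∀ c ∈ arms, 0 ≤ sSup (μh '' arms) - μh c := fun c hc => by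
    rw [hsup e he]
    exact sub_nonneg.2 ((hEsub he).2 hc)
  have hTpos : (0 : ℝ) < √T := by positivity
  have h1 : sSup (μh '' arms) - μh a ≤ √(w a) * √(Real.log T) := by
    by_cases haE : a ∈ E
    · rw [hsup a haE, sub_self]
      positivity
    · have h := hmin e (hEsub he).1
      rw [show (e ∈ E) = True from eq_true he] at h
      have h2 := sq_gap_le_of_armIndex_le (hw a) hwa haE h
      rw [← Real.sqrt_mul (hw a)]
      exact Real.le_sqrt_of_sq_le h2
  have h2 : √(w b) - (sSup (μh '' arms) - μh b) ≤ 2 * √(w a) + 2 / √T := by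
    by_cases hlt : √(w b) ≤ sSup (μh '' arms) - μh b
    · have : 0 ≤ 2 * √(w a) + 2 / √T := by positivity
      linarith
    · rw [not_le] at hlt
      have hwb : 0 < w b := Real.sqrt_pos.1 ((hgap b hb).trans_lt hlt)
      have hg : (sSup (μh '' arms) - μh b) ^ 2 ≤ w b := by
        rw [← Real.sq_sqrt hwb.le]
        have := hgap b hb
        gcongr
      have hs4 : √(4 : ℝ) = 2 := by
        rw [show (4 : ℝ) = 2 ^ 2 by norm_num]
        exact Real.sqrt_sq (by norm_num)
      have h3 : √(w b) ≤ 2 * √(w a) + 2 / √T := by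
        rcases le_of_armIndex_le (hw a) hwb hg hT (hmin b hb) with h | h
        · have := Real.sqrt_le_sqrt h
          rw [Real.sqrt_mul (by norm_num), hs4] at this
          have : 0 ≤ 2 / √(T : ℝ) := by positivity
          linarith
        · have := Real.sqrt_le_sqrt h
          rw [Real.sqrt_div (by norm_num), hs4] at this
          linarith [Real.sqrt_nonneg (w a)]
      linarith [hgap b hb]
  have h3 := abs_le.1 (hconf a)
  have h4 := abs_le.1 (hconf b)
  nlinarith

/-! ### The confidence radius -/

theorem sqrt_confRadius {d : ℕ} {L S R lam : ℝ} (hS : 0 ≤ S) (hR : 0 ≤ R) (t : ℕ) (γ : ℝ) :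
    √(confRadius d L S R lam t γ) =
      R * √(d * Real.log ((1 + t * L ^ 2 / lam) / γ)) + √lam * S := by
  rw [confRadius, Real.sqrt_sq (by positivity)]

/-- The self-normalized bound with failure probability `1 / t` is covered by the radius
`β_{t-1}(1 / t²)`: as `1 ≤ d`, the term `2 log t` is at most `d log (t²)`. -/
theorem sqrt_noiseNormSq_add_le {d : ℕ} (hd : 1 ≤ d) {L S R lam : ℝ} (hS : 0 ≤ S) (hR : 0 ≤ R)
    (hlam : 0 < lam) {X : ℕ → EuclideanSpace ℝ (Fin d)} {η : ℕ → ℝ} {t : ℕ} (ht : 1 ≤ t)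
    (hX : ∀ s ∈ Finset.Icc 1 (t - 1), ‖X s‖ ≤ L)
    (h : noiseNormSq lam X η (t - 1) ≤ R ^ 2 *
      (Real.log ((designMatrix lam X (t - 1)).det / lam ^ d) + 2 * Real.log (1 / (1 / (t : ℝ))))) :
    √(noiseNormSq lam X η (t - 1)) + √lam * S ≤
      √(confRadius d L S R lam (t - 1) (1 / (t : ℝ) ^ 2)) := by
  rw [sqrt_confRadius hS hR]
  gcongr
  rw [Real.sqrt_le_left (by positivity), mul_pow, Real.sq_sqrt]
  · refine h.trans ?_
    gcongr
    have ht' : (1 : ℝ) ≤ t := by exact_mod_cast ht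
    have hdet := (designMatrix_posDef X hlam (t - 1)).det_pos
    have h1 : Real.log ((designMatrix lam X (t - 1)).det / lam ^ d) ≤
        d * Real.log (1 + (t - 1 : ℕ) * L ^ 2 / lam) := by
      rw [← Real.log_pow]
      gcongr
      rw [div_le_iff₀' (by positivity)]
      exact det_designMatrix_le X hlam _ hX
    have h2 : (0 : ℝ) ≤ Real.log t := Real.log_nonneg ht'
    have hd' : (1 : ℝ) ≤ d := by exact_mod_cast hd
    rw [one_div_one_div, div_div_eq_mul_div, div_one, Real.log_mul (by positivity) (by positivity),
      Real.log_pow, mul_add]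
    push_cast
    nlinarith
  · refine mul_nonneg (Nat.cast_nonneg _) (Real.log_nonneg ?_)
    have ht' : (1 : ℝ) ≤ t := by exact_mod_cast ht
    rw [div_div_eq_mul_div, div_one]
    have : (1 : ℝ) ≤ 1 + (t - 1 : ℕ) * L ^ 2 / lam := by
      have : (0 : ℝ) ≤ (t - 1 : ℕ) * L ^ 2 / lam := by positivity
      linarith
    nlinarith [one_le_pow₀ ht' (n := 2)]

/-- The logarithmic factors are of order `log T`, since `1 + T L² / lam ≤ (1 + L² / lam) T`. -/
theorem log_one_add_mul_sq_le {L lam : ℝ} (hlam : 0 < lam) {T : ℕ} (hT : 2 ≤ T) {t : ℕ}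
    (ht : 1 ≤ t) (htT : t ≤ T) :
    Real.log ((1 + (t - 1 : ℕ) * L ^ 2 / lam) / (1 / (t : ℝ) ^ 2)) ≤
        (2 * Real.log (1 + L ^ 2 / lam) + 3) * Real.log T ∧
      Real.log (1 + T * L ^ 2 / lam) ≤ (2 * Real.log (1 + L ^ 2 / lam) + 3) * Real.log T := by
  have hT' : (2 : ℝ) ≤ T := by exact_mod_cast hT
  have htT' : (t : ℝ) ≤ T := by exact_mod_cast htT
  have ht' : (1 : ℝ) ≤ t := by exact_mod_cast ht
  have hl : 1 ≤ 2 * Real.log T := by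
    have h1 := Real.log_two_gt_d9
    have h2 := Real.log_le_log (by norm_num) hT'
    linarith
  have hc : 0 ≤ Real.log (1 + L ^ 2 / lam) :=
    Real.log_nonneg (by have : 0 ≤ L ^ 2 / lam := by positivity
                        linarith)
  have hprod : Real.log ((1 + L ^ 2 / lam) * T ^ 3) ≤
      (2 * Real.log (1 + L ^ 2 / lam) + 3) * Real.log T := by
    rw [Real.log_mul (by positivity) (by positivity), Real.log_pow]
    push_cast
    nlinarith
  have hq : 0 ≤ L ^ 2 / lam := by positivity
  have h1 : 1 + T * L ^ 2 / lam ≤ (1 + L ^ 2 / lam) * T := by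
    rw [mul_div_assoc]
    nlinarith
  have ht1 : ((t - 1 : ℕ) : ℝ) ≤ T := by
    have : t - 1 ≤ T := by omega
    exact_mod_cast this
  constructor
  · refine (Real.log_le_log (by positivity) ?_).trans hprod
    rw [div_div_eq_mul_div, div_one]
    calc (1 + (t - 1 : ℕ) * L ^ 2 / lam) * (t : ℝ) ^ 2 ≤ (1 + T * L ^ 2 / lam) * (T : ℝ) ^ 2 := by
          gcongr
      _ ≤ ((1 + L ^ 2 / lam) * T) * (T : ℝ) ^ 2 := by gcongr
      _ = _ := by ring
  · refine (Real.log_le_log (by positivity) ?_).trans hprod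
    refine h1.trans ?_
    gcongr
    exact le_self_pow₀ (by linarith) (by norm_num)

/-! ### Failure probability of the confidence bounds -/

section History

variable {Ω Arm : Type*} {m0 : MeasurableSpace Ω} [MeasurableSpace Arm] {d T : ℕ}
  {B : Bandit d Arm} {A : ℕ → Ω → Arm} {η : ℕ → Ω → ℝ}

theorem measurable_arm_history (Y : ℕ → Ω → ℝ) {t s : ℕ} (hs : s ∈ Finset.Icc 1 t) :
    Measurable[history A Y t] (A s) := by
  rw [measurable_iff_comap_le]
  exact (le_iSup₂_of_le (f := fun s (_ : s ∈ Set.Icc 1 t) =>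
    MeasurableSpace.comap (A s) inferInstance) s (by simpa using hs) le_rfl).trans le_sup_left

theorem measurable_reward_history (A : ℕ → Ω → Arm) (Y : ℕ → Ω → ℝ) {t s : ℕ}
    (hs : s ∈ Finset.Ico 1 t) : Measurable[history A Y t] (Y s) := by
  rw [measurable_iff_comap_le]
  exact (le_iSup₂_of_le (f := fun s (_ : s ∈ Set.Ico 1 t) =>
    MeasurableSpace.comap (Y s) inferInstance) s (by simpa using hs) le_rfl).trans le_sup_right

theorem measurable_mean {t : ℕ} (h : Measurable (B.ctx t)) : Measurable (B.mean t) := by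
  unfold Bandit.mean
  fun_prop

theorem measurable_reward (hctx : ∀ t ∈ Finset.Icc 1 T, Measurable (B.ctx t))
    (hA : ∀ t ∈ Finset.Icc 1 T, Measurable (A t)) (hη : ∀ t ∈ Finset.Icc 1 T, Measurable (η t))
    {t : ℕ} (ht : t ∈ Finset.Icc 1 T) : Measurable (B.reward A η t) :=
  ((measurable_mean (hctx t ht)).comp (hA t ht)).add (hη t ht)

theorem history_le (hctx : ∀ t ∈ Finset.Icc 1 T, Measurable (B.ctx t))
    (hA : ∀ t ∈ Finset.Icc 1 T, Measurable (A t)) (hη : ∀ t ∈ Finset.Icc 1 T, Measurable (η t))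
    {t : ℕ} (ht : t ∈ Finset.Icc 1 T) : history A (B.reward A η) t ≤ m0 := by
  have hT := (Finset.mem_Icc.1 ht).2
  refine sup_le (iSup₂_le fun s hs => ?_) (iSup₂_le fun s hs => ?_)
  · exact (hA s (by simp at hs ⊢; omega)).comap_le
  · exact (measurable_reward hctx hA hη (by simp at hs ⊢; omega)).comap_le

theorem measurable_noise_history (hctx : ∀ t ∈ Finset.Icc 1 T, Measurable (B.ctx t))
    {t : ℕ} (ht : t ∈ Finset.Icc 1 T) {s : ℕ} (hs : s ∈ Finset.Ico 1 t) :
    Measurable[history A (B.reward A η) t] (η s) := by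
  have h1 := measurable_reward_history A (B.reward A η) hs
  have h2 : Measurable[history A (B.reward A η) t] (A s) :=
    measurable_arm_history _ (by simp at hs ⊢; omega)
  have h3 := (measurable_mean (B := B) (hctx s (by simp at hs ht ⊢; omega))).comp h2
  have : η s = fun ω => B.reward A η s ω - (B.mean s ∘ A s) ω := by
    funext ω
    simp [Bandit.reward]
  rw [this]
  exact h1.sub h3

/-- In round `t` the confidence bound fails with probability at most `1 / t`. -/
theorem measure_confidence_failure_le {P : Measure Ω} [IsProbabilityMeasure P] {L S R lam : ℝ}
    (hd : 1 ≤ d) (hR : 0 ≤ R) (hlam : 0 < lam)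
    (hctx : ∀ t ∈ Finset.Icc 1 T, Measurable (B.ctx t))
    (hA : ∀ t ∈ Finset.Icc 1 T, Measurable (A t)) (hη : ∀ t ∈ Finset.Icc 1 T, Measurable (η t))
    (hsub : ∀ t ∈ Finset.Icc 1 T, IsCondSubGaussian P (history A (B.reward A η) t) (η t) R)
    (hL : ∀ t ∈ Finset.Icc 1 T, ∀ ω, ‖B.ctx t (A t ω)‖ ≤ L) (hθ : ‖B.theta‖ ≤ S)
    {t : ℕ} (ht : t ∈ Finset.Icc 1 T) :
    P {ω | ¬ ∀ a, |B.empMean lam (fun t => A t ω) (fun t => B.reward A η t ω) t a - B.mean t a| ≤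
      √(B.width L S R lam (fun t => A t ω) t a)} ≤ ENNReal.ofReal (1 / t) := by
  have ht1 : 1 ≤ t := (Finset.mem_Icc.1 ht).1
  have htT : t ≤ T := (Finset.mem_Icc.1 ht).2
  have htail := measure_lt_noiseNormSq_le (P := P) (X := fun s ω => B.ctx s (A s ω)) (η := η)
    (m := history A (B.reward A η)) (T := T) (t := t - 1) (δ := 1 / t) hlam hR
    (fun t ht => history_le hctx hA hη ht)
    (fun t ht s hs => (hctx s (by simp at hs ht ⊢; omega)).comp (measurable_arm_history _ hs))
    (fun t ht s hs => measurable_noise_history hctx ht hs) hη hsub (by omega)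
    (by have : 0 < t := ht1
        positivity)
  refine (measure_mono fun ω hω => ?_).trans htail
  rw [Set.mem_ofPred_eq] at hω ⊢
  by_contra hle
  refine hω fun a => ?_
  have hbeta := sqrt_noiseNormSq_add_le (S := S) hd ((norm_nonneg _).trans hθ) hR hlam ht1
    (fun s hs => hL s (by simp at hs ⊢; omega) ω) (not_lt.1 hle)
  have herr := abs_inner_ridgeEstimate_sub_le (fun s => B.ctx s (A s ω)) hlam hθ
    (Y := fun s => B.reward A η s ω) (η := fun s => η s ω) (fun s => rfl) (t - 1) (B.ctx t a)
  rw [Bandit.width, Real.sqrt_mul (by unfold confRadius; positivity),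
    Real.sqrt_sq (by unfold mahalanobisNorm; positivity)]
  exact herr.trans (mul_le_mul_of_nonneg_right hbeta (by unfold mahalanobisNorm; positivity))

end History

/-! ### Summation over the rounds -/

theorem one_le_two_mul_log {T : ℕ} (hT : 2 ≤ T) : 1 ≤ 2 * Real.log T := by
  have h1 := Real.log_two_gt_d9
  have h2 : Real.log 2 ≤ Real.log T := Real.log_le_log (by norm_num) (by exact_mod_cast hT)
  linarith

/-- The square roots of the elliptical potential, by Cauchy–Schwarz. -/
theorem sum_sqrt_min_one_potential_le {d : ℕ} {lam L : ℝ} (X : ℕ → EuclideanSpace ℝ (Fin d))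
    (hlam : 0 < lam) (T : ℕ) (hX : ∀ s ∈ Finset.Icc 1 T, ‖X s‖ ≤ L) :
    ∑ s ∈ Finset.range T, √(min 1 (potential lam X s)) ≤
      √(T * (2 * (d * Real.log (1 + T * L ^ 2 / lam)))) := by
  apply Real.le_sqrt_of_sq_le
  refine (sq_sum_le_card_mul_sum_sq (s := Finset.range T)
    (f := fun s => √(min 1 (potential lam X s)))).trans ?_
  rw [Finset.card_range]
  gcongr
  refine le_trans (le_of_eq ?_) (sum_min_one_potential_le X hlam T hX)
  exact Finset.sum_congr rfl fun s _ =>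
    Real.sq_sqrt (le_min zero_le_one (potential_nonneg X hlam s))

theorem sum_one_div_le (T : ℕ) : ∑ t ∈ Finset.Icc 1 T, (1 / t : ℝ) ≤ 1 + Real.log T := by
  have h := harmonic_le_one_add_log T
  rw [harmonic_eq_sum_Icc] at h
  push_cast at h
  simpa using h

section Regret

variable {Arm : Type*} {d T : ℕ} {B : Bandit d Arm}

theorem bestMean_eq {t : ℕ} {a : Arm} (ha : a ∈ B.arms t) (hmax : IsMaxOn (B.mean t) (B.arms t) a) :
    B.bestMean t = B.mean t a :=
  IsGreatest.csSup_eq ⟨⟨a, ha, rfl⟩, by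
    rintro _ ⟨x, hx, rfl⟩
    exact hmax hx⟩

theorem sqrt_width_le {L S R lam b : ℝ} (hlam : 0 < lam) {A : ℕ → Arm} {t : ℕ} (ht : 1 ≤ t)
    (hb : √(confRadius d L S R lam (t - 1) (1 / (t : ℝ) ^ 2)) ≤ b) :
    √(B.width L S R lam A t (A t)) ≤ b * √(potential lam (fun s => B.ctx s (A s)) (t - 1)) := by
  rw [Bandit.width, mahalanobisNorm_sq _ hlam, Real.sqrt_mul (by unfold confRadius; positivity),
    potential, Nat.sub_add_cancel ht]
  gcongr

/-- The regret of a round in which the confidence bounds hold, in terms of the truncated potential: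
large widths are absorbed by the bound `1` on the regret, as `b ≥ 1`. -/
theorem regret_round_le {L S R lam b : ℝ} (hlam : 0 < lam) (hT : 0 < T) {A : ℕ → Arm} {Y : ℕ → ℝ}
    {t : ℕ} (ht : t ∈ Finset.Icc 1 T) (hrun : B.IsLinIMED2Run T L S R lam A Y)
    (hopt : ∃ a ∈ B.arms t, IsMaxOn (B.mean t) (B.arms t) a)
    (hone : ∀ b ∈ B.arms t, B.bestMean t - B.mean t b ≤ 1)
    (hconf : ∀ a, |B.empMean lam A Y t a - B.mean t a| ≤ √(B.width L S R lam A t a))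
    (hb1 : 1 ≤ b) (hb : √(confRadius d L S R lam (t - 1) (1 / (t : ℝ) ^ 2)) ≤ b) :
    B.bestMean t - B.mean t (A t) ≤
      b * (√(Real.log T) + 3) * √(min 1 (potential lam (fun s => B.ctx s (A s)) (t - 1))) +
        2 / √T := by
  obtain ⟨E, hEne, hEsub, hAt, hmin⟩ := hrun t ht
  obtain ⟨o, ho, homax⟩ := hopt
  have h1 := hone _ hAt
  have hl := Real.sqrt_nonneg (Real.log T)
  have h2T : 0 ≤ 2 / √(T : ℝ) := by positivity
  have hbpos : 0 ≤ b * (√(Real.log T) + 3) := by positivity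
  rcases le_total 1 (potential lam (fun s => B.ctx s (A s)) (t - 1)) with hu | hu
  · rw [min_eq_left hu, Real.sqrt_one]
    nlinarith
  rw [min_eq_right hu]
  have hw := sqrt_width_le (B := B) (A := A) hlam (Finset.mem_Icc.1 ht).1 hb
  have hwl : √(B.width L S R lam A t (A t)) * (√(Real.log T) + 3) ≤
      b * (√(Real.log T) + 3) * √(potential lam (fun s => B.ctx s (A s)) (t - 1)) := by
    calc _ ≤ (b * √(potential lam (fun s => B.ctx s (A s)) (t - 1))) * (√(Real.log T) + 3) := by
          gcongr
      _ = _ := by ring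
  rcases le_total (B.width L S R lam A t (A t)) 1 with hw1 | hw1
  · have hw0 : ∀ a, 0 ≤ B.width L S R lam A t a := fun a => by
      unfold Bandit.width confRadius
      positivity
    have h3 := regret_le_of_abs_sub_le hT hw0 hconf hEne hEsub hmin hw1 ho
    rw [bestMean_eq ho homax]
    linarith
  · have := Real.one_le_sqrt.2 hw1
    nlinarith

end Regret

/-- The radius is of order `√(d log T)`. -/
theorem sqrt_confRadius_le {d : ℕ} (hd : 1 ≤ d) {L S R lam : ℝ} (hS : 0 ≤ S) (hR : 0 ≤ R)
    (hlam : 0 < lam) {T : ℕ} (hT : 2 ≤ T) {t : ℕ} (ht : t ∈ Finset.Icc 1 T) :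
    √(confRadius d L S R lam (t - 1) (1 / (t : ℝ) ^ 2)) ≤
      (R * √(2 * Real.log (1 + L ^ 2 / lam) + 3) + 2 * (√lam * S)) * √(d * Real.log T) := by
  have hd' : (1 : ℝ) ≤ d := by exact_mod_cast hd
  have hl := one_le_two_mul_log hT
  have h := (log_one_add_mul_sq_le (L := L) hlam hT (Finset.mem_Icc.1 ht).1
    (Finset.mem_Icc.1 ht).2).1
  have hc : 0 ≤ Real.log (1 + L ^ 2 / lam) :=
    Real.log_nonneg (by have : 0 ≤ L ^ 2 / lam := by positivity
                        linarith)
  have h2 : (1 : ℝ) ≤ 2 * √(d * Real.log T) := by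
    have : (1 / 2 : ℝ) ≤ √(d * Real.log T) := Real.le_sqrt_of_sq_le (by nlinarith)
    linarith
  rw [sqrt_confRadius hS hR, add_mul, mul_assoc R, ← Real.sqrt_mul (by positivity)]
  have h3 : √lam * S ≤ 2 * (√lam * S) * √(d * Real.log T) := by
    have : 0 ≤ √lam * S := by positivity
    nlinarith
  have h4 : d * Real.log ((1 + (t - 1 : ℕ) * L ^ 2 / lam) / (1 / (t : ℝ) ^ 2)) ≤
      (2 * Real.log (1 + L ^ 2 / lam) + 3) * (d * Real.log T) := by
    nlinarith
  gcongr

/-- Collects the contributions of the confidence widths, of the cap `log T` of the index, and of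
the failures of the confidence bounds. -/
theorem regret_total_le {K c : ℝ} (hK : 0 ≤ K) (hc : 0 ≤ c) {d T : ℕ} (hd : 1 ≤ d) (hT : 2 ≤ T) {p : ℝ}
    (hp : p ≤ c * Real.log T) :
    K * √(d * Real.log T) * (√(Real.log T) + 3) * √(T * (2 * (d * p))) + T * (2 / √T) +
      (1 + Real.log T) ≤ (7 * K * √(2 * c) + 14) * d * √T * Real.log T ^ (3 / 2 : ℝ) := by
  have hd' : (1 : ℝ) ≤ d := by exact_mod_cast hd
  have hl := one_le_two_mul_log hT
  set l := Real.log T with hldef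
  have hl0 : 0 < l := by linarith
  have hsl : 1 / 2 ≤ √l := Real.le_sqrt_of_sq_le (by linarith)
  have hsT : (1 : ℝ) ≤ √T := Real.one_le_sqrt.2 (by exact_mod_cast (by omega : 1 ≤ T))
  have hpow : l ^ (3 / 2 : ℝ) = l * √l := by
    rw [show (3 / 2 : ℝ) = 1 + 1 / 2 by norm_num, Real.rpow_add hl0, Real.rpow_one,
      Real.sqrt_eq_rpow]
  have h1 : √(T * (2 * (d * p))) ≤ √T * √(2 * c) * √(d * l) := by
    rw [← Real.sqrt_mul (by positivity), ← Real.sqrt_mul (by positivity)]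
    apply Real.sqrt_le_sqrt
    calc (T : ℝ) * (2 * (d * p)) ≤ T * (2 * (d * (c * l))) := by gcongr
      _ = _ := by ring
  have h2 : K * √(d * l) * (√l + 3) * √(T * (2 * (d * p))) ≤
      7 * K * √(2 * c) * d * √T * (l * √l) := by
    calc _ ≤ K * √(d * l) * (7 * √l) * (√T * √(2 * c) * √(d * l)) := by
          gcongr
          linarith
      _ = 7 * K * √(2 * c) * (√(d * l) * √(d * l)) * √T * √l := by ring
      _ = _ := by rw [Real.mul_self_sqrt (by positivity)]; ring
  have h3 : (T : ℝ) * (2 / √T) = 2 * √T := by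
    have : (T : ℝ) = √T * √T := (Real.mul_self_sqrt (by positivity)).symm
    rw [mul_div_assoc', div_eq_iff (by positivity)]
    linarith
  have h4 : l ≤ 2 * (l * √l) := by nlinarith
  have h5 : 2 * √T + (1 + l) ≤ 14 * d * √T * (l * √l) := by
    have h6 : 2 * √T + (1 + l) ≤ 14 * √T * (l * √l) := by nlinarith
    have h7 : 0 ≤ 14 * √T * (l * √l) := by positivity
    nlinarith
  rw [h3, hpow]
  linarith

end LinIMED

theorem theorem2 (L S R lam : ℝ) (hL : 0 < L) (hS : 0 < S) (hR : 0 ≤ R) (hlam : 0 < lam)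
    (hlamS : 1 ≤ √lam * S) :
    ∃ C : ℝ, ∀ (d T : ℕ), 2 ≤ T →
      ∀ (Arm : Type*) [MeasurableSpace Arm] (Ω : Type*) [MeasurableSpace Ω]
        (P : MeasureTheory.Measure Ω) [MeasureTheory.IsProbabilityMeasure P]
        (B : LinIMED.Bandit d Arm) (A : ℕ → Ω → Arm) (η : ℕ → Ω → ℝ),
        -- measurability
        (∀ t ∈ Finset.Icc 1 T, Measurable (B.ctx t)) →
        (∀ t ∈ Finset.Icc 1 T, Measurable (A t)) →
        (∀ t ∈ Finset.Icc 1 T, Measurable (η t)) →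
        -- conditionally sub-Gaussian noise
        (∀ t ∈ Finset.Icc 1 T,
          LinIMED.IsCondSubGaussian P (LinIMED.history A (B.reward A η) t) (η t) R) →
        -- an optimal arm exists in every round
        (∀ t ∈ Finset.Icc 1 T, ∃ a ∈ B.arms t, IsMaxOn (B.mean t) (B.arms t) a) →
        -- boundedness
        (∀ t ∈ Finset.Icc 1 T, ∀ ω, ‖B.ctx t (A t ω)‖ ≤ L) →
        ‖B.theta‖ ≤ S →
        (∀ t ∈ Finset.Icc 1 T, ∀ b ∈ B.arms t, B.bestMean t - B.mean t b ≤ 1) →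
        -- the arms are pulled by LinIMED-2
        (∀ ω, B.IsLinIMED2Run T L S R lam (fun t => A t ω) (fun t => B.reward A η t ω)) →
        B.expectedRegret P A T ≤ C * d * √T * Real.log T ^ (3 / 2 : ℝ) := by
  open LinIMED in
  -- The radius is at most `K √(d log T)`, and the logarithms of determinants at most `c d log T`.
  set c : ℝ := 2 * Real.log (1 + L ^ 2 / lam) + 3 with hcdef
  set K : ℝ := R * √c + 2 * (√lam * S) with hKdef
  refine ⟨7 * K * √(2 * c) + 14, ?_⟩
  intro d T hT Arm _ Ω _ P _ B A η hctx hA hη hsub hopt hXL hθ hone hrun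
  rcases Nat.eq_zero_or_pos d with rfl | hd
  · -- In dimension zero all means vanish, hence so does the regret.
    have hmean : ∀ t a, B.mean t a = 0 := fun t a => by
      simp [Bandit.mean, Subsingleton.elim (B.ctx t a) 0]
    have hzero : ∀ ω, ∑ t ∈ Finset.Icc 1 T, (B.bestMean t - B.mean t (A t ω)) = 0 := fun ω =>
      Finset.sum_eq_zero fun t ht => by
        obtain ⟨a, ha, hmax⟩ := hopt t ht
        rw [bestMean_eq ha hmax, hmean, hmean, sub_zero]
    simp [Bandit.expectedRegret, hzero]
  have hd' : (1 : ℝ) ≤ d := by exact_mod_cast hd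
  have hl := one_le_two_mul_log hT
  have hc : 0 ≤ c := by
    have : 0 ≤ L ^ 2 / lam := by positivity
    have := Real.log_nonneg (by linarith : 1 ≤ 1 + L ^ 2 / lam)
    positivity
  have hK2 : 2 ≤ K := by
    have : 0 ≤ R * √c := by positivity
    linarith
  have hb1 : 1 ≤ K * √(d * Real.log T) := by
    have : (1 / 2 : ℝ) ≤ √(d * Real.log T) := Real.le_sqrt_of_sq_le (by nlinarith)
    nlinarith
  -- Measurable sets that contain the failure events of the confidence bounds.
  set N : ℕ → Set Ω := fun t => toMeasurable P {ω | ¬ ∀ a,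
    |B.empMean lam (fun t => A t ω) (fun t => B.reward A η t ω) t a - B.mean t a| ≤
      √(B.width L S R lam (fun t => A t ω) t a)} with hN
  have hNm : ∀ t, MeasurableSet (N t) := fun t => measurableSet_toMeasurable _ _
  have hNP : ∀ t ∈ Finset.Icc 1 T, P.real (N t) ≤ 1 / t := fun t ht => by
    refine ENNReal.toReal_le_of_le_ofReal (by positivity) ?_
    rw [hN, measure_toMeasurable]
    exact measure_confidence_failure_le hd hR hlam hctx hA hη hsub hXL hθ ht
  set D : ℝ := K * √(d * Real.log T) * (√(Real.log T) + 3) *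
    √(T * (2 * (d * Real.log (1 + T * L ^ 2 / lam)))) + T * (2 / √T) with hD
  have hround : ∀ ω, ∀ t ∈ Finset.Icc 1 T, B.bestMean t - B.mean t (A t ω) ≤
      K * √(d * Real.log T) * (√(Real.log T) + 3) *
        √(min 1 (potential lam (fun s => B.ctx s (A s ω)) (t - 1))) + 2 / √T +
        (N t).indicator 1 ω := by
    intro ω t ht
    by_cases hω : ω ∈ N t
    · obtain ⟨E, -, -, hAt, -⟩ := hrun ω t ht
      have h1 := hone t ht _ hAt
      rw [Set.indicator_of_mem hω, Pi.one_apply]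
      have : 0 ≤ K * √(d * Real.log T) * (√(Real.log T) + 3) *
        √(min 1 (potential lam (fun s => B.ctx s (A s ω)) (t - 1))) + 2 / √T := by positivity
      linarith
    · rw [Set.indicator_of_notMem hω, add_zero]
      have hgood := not_not.1 fun h => hω (subset_toMeasurable P _ h)
      exact regret_round_le hlam (by omega) ht (hrun ω) (hopt t ht) (hone t ht) hgood hb1
        (sqrt_confRadius_le hd hS.le hR hlam hT ht)
  have hsum : ∀ ω, ∑ t ∈ Finset.Icc 1 T, (B.bestMean t - B.mean t (A t ω)) ≤
      D + ∑ t ∈ Finset.Icc 1 T, (N t).indicator (1 : Ω → ℝ) ω := by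
    intro ω
    refine (Finset.sum_le_sum (hround ω)).trans ?_
    rw [Finset.sum_add_distrib, Finset.sum_add_distrib, ← Finset.mul_sum, Finset.sum_const,
      Nat.card_Icc, Nat.add_sub_cancel, nsmul_eq_mul, hD]
    gcongr
    refine le_trans (le_of_eq ?_) (sum_sqrt_min_one_potential_le (fun s => B.ctx s (A s ω)) hlam T
      fun s hs => hXL s hs ω)
    rw [← Finset.Ico_add_one_right_eq_Icc, Finset.sum_Ico_eq_sum_range]
    simp [add_comm]
  have hint : ∀ t ∈ Finset.Icc 1 T, Integrable ((N t).indicator (1 : Ω → ℝ)) P := fun t _ =>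
    (integrable_const 1).indicator (hNm t)
  have hnonneg : ∀ ω, 0 ≤ ∑ t ∈ Finset.Icc 1 T, (B.bestMean t - B.mean t (A t ω)) := fun ω =>
    Finset.sum_nonneg fun t ht => by
      obtain ⟨E, -, -, hAt, -⟩ := hrun ω t ht
      obtain ⟨a, ha, hmax⟩ := hopt t ht
      rw [bestMean_eq ha hmax]
      exact sub_nonneg.2 (hmax hAt)
  calc B.expectedRegret P A T
      ≤ ∫ ω, (D + ∑ t ∈ Finset.Icc 1 T, (N t).indicator (1 : Ω → ℝ) ω) ∂P :=
        integral_mono_of_nonneg (ae_of_all _ hnonneg)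
          ((integrable_const D).add (integrable_finsetSum _ hint)) (ae_of_all _ hsum)
    _ = D + ∑ t ∈ Finset.Icc 1 T, P.real (N t) := by
        rw [integral_add (integrable_const D) (integrable_finsetSum _ hint),
          integral_finsetSum _ hint]
        simp [integral_indicator_one (hNm _)]
    _ ≤ D + (1 + Real.log T) := by
        gcongr
        exact (Finset.sum_le_sum hNP).trans (sum_one_div_le T)
    _ ≤ _ := regret_total_le (by linarith) hc hd hT
        (log_one_add_mul_sq_le hlam hT (by omega : 1 ≤ T) le_rfl).2
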